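/- Consider a single-server batch-service queue with an infinite buffer. Jobs $1,2,\ldots$ arrive at the epochs $t_1<t_2<\cdots$ of a Poisson process with rate $\lambda>0$. At time $0$ the server is idle and the buffer is empty. Whenever the server is idle and at least one job is waiting, all waiting jobs are put into a single batch (there is no maximum batch size), and its processing starts immediately. A batch of size $b$ takes the deterministic processing time $\tau^{[b]}=\alpha b+\tau_0$, where $\alpha>0$ and $\tau_0\ge 0$, and all its jobs depart at its completion. Assume the stability condition $\lambda\alpha<1$. Let $W_n$ be the latency of the $n$th job, i.e. its departure time minus its arrival time, and let the mean latency $\mathrm{E}[W]$ (of a randomly chosen job in the long run) be the almost sure limit of $\frac1N\sum_{n=1}^N W_n$ as $N\to\infty$. Then this limit exists almost surely, it is a finite constant, and $$\mathrm{E}[W]\le \phi_0(\lambda,\alpha,\tau_0):=\frac{\alpha+\tau_0}{2(1-\lambda\alpha)}\left(1+2\lambda\tau_0+\frac{1-\lambda\tau_0}{1+\lambda\alpha}\right),$$ $$\mathrm{E}[W]\le \phi_1(\lambda,\alpha,\tau_0):=\frac32\cdot\frac{\tau_0}{1-\lambda\alpha}+\frac{\alpha}{2}\cdot\frac{\lambda\alpha+2}{1-\lambda^2\alpha^2}.$$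 Moreover, $\phi_0(\lambda,\alpha,\tau_0)\le\phi_1(\lambda,\alpha,\tau_0)$ if and only if $\lambda\le 1/(\alpha+\tau_0)$. -/

import Mathlib

open MeasureTheory ProbabilityTheory Filter Topology

namespace BatchQueue

/-- Arrival epoch of job `n` (`n = 0, 1, 2, …`) when the successive interarrival times are
`T 0, T 1, …`; time starts at `0` with an empty system. -/
noncomputable def arrival (T : ℕ → ℝ) (n : ℕ) : ℝ := ∑ i ∈ Finset.range (n + 1), T i

/-- Number of jobs that arrive in the time interval `[0, x]`. -/
noncomputable def numArrived (T : ℕ → ℝ) (x : ℝ) : ℕ := Set.ncard {n : ℕ | arrival T n ≤ x}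

/-- A batch, consisting of the jobs with index `n` such that `first ≤ n < next`, whose processing
is initiated at time `start`. -/
structure Batch where
  first : ℕ
  next : ℕ
  start : ℝ

/-- The number of jobs in a batch. -/
def Batch.size (β : Batch) : ℕ := β.next - β.first

/-- The time at which the processing of the batch is completed, where `τ b` is the processing
time of a batch of size `b`. -/
noncomputable def Batch.finish (τ : ℕ → ℝ) (β : Batch) : ℝ := β.start + τ β.size

/-- The batch that is formed if the server becomes idle at time `d` and exactly the jobs with index
smaller than `m` have been processed by then. Processing starts as soon as there is a waiting job:
at time `d` if job `m` has arrived by then, and at its arrival epoch otherwise.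
All jobs that are waiting at the start are put into the batch (no maximum batch size). -/
noncomputable def formBatch (T : ℕ → ℝ) (m : ℕ) (d : ℝ) : Batch where
  first := m
  next := numArrived T (max d (arrival T m))
  start := max d (arrival T m)

/-- The successive batches; the server is idle and the buffer is empty at time `0`. -/
noncomputable def batch (τ : ℕ → ℝ) (T : ℕ → ℝ) : ℕ → Batch
  | 0 => formBatch T 0 0
  | k + 1 => formBatch T (batch τ T k).next ((batch τ T k).finish τ)

/-- The index of the batch that contains job `n`. -/
noncomputable def batchOf (τ : ℕ → ℝ) (T : ℕ → ℝ) (n : ℕ) : ℕ :=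
  sInf {k : ℕ | n < (batch τ T k).next}

/-- The departure time of job `n`: the completion time of its batch. -/
noncomputable def departure (τ : ℕ → ℝ) (T : ℕ → ℝ) (n : ℕ) : ℝ :=
  (batch τ T (batchOf τ T n)).finish τ

/-- The latency (sojourn time) of job `n`. -/
noncomputable def latency (τ : ℕ → ℝ) (T : ℕ → ℝ) (n : ℕ) : ℝ :=
  departure τ T n - arrival T n

/-- `T 0, T 1, …` are the interarrival times of a Poisson process with rate `lam`: they are
independent and exponentially distributed with parameter `lam`. -/
structure IsPoissonInput {Ω : Type*} [MeasurableSpace Ω] (P : Measure Ω) (lam : ℝ)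
    (T : ℕ → Ω → ℝ) : Prop where
  hasLaw : ∀ n, HasLaw (T n) (expMeasure lam) P
  indep : iIndepFun T P

/-- `w` is the mean latency (the mean sojourn time of a randomly chosen job in the long run):
almost surely, the average latency of the first `N` jobs converges to `w` as `N → ∞`. -/
def IsMeanLatency {Ω : Type*} [MeasurableSpace Ω] (P : Measure Ω) (τ : ℕ → ℝ)
    (T : ℕ → Ω → ℝ) (w : ℝ) : Prop :=
  ∀ᵐ ω ∂P, Tendsto
    (fun N : ℕ => (∑ n ∈ Finset.range N, latency τ (fun i => T i ω) n) / (N : ℝ))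
    atTop (𝓝 w)

/-- The linear batch processing time `τ^[b] = α b + τ₀`. -/
noncomputable def linearTime (α τ₀ : ℝ) (b : ℕ) : ℝ := α * b + τ₀

/-- The upper bound `φ₀`. -/
noncomputable def phi0 (lam α τ₀ : ℝ) : ℝ :=
  (α + τ₀) / (2 * (1 - lam * α)) * (1 + 2 * lam * τ₀ + (1 - lam * τ₀) / (1 + lam * α))

/-- The upper bound `φ₁`. -/
noncomputable def phi1 (lam α τ₀ : ℝ) : ℝ :=
  3 / 2 * (τ₀ / (1 - lam * α)) + α / 2 * ((lam * α + 2) / (1 - lam ^ 2 * α ^ 2))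

end BatchQueue

/-! Observed just after arrivals, the pair (waiting jobs `q`, residual processing time `r`) is a
Markov chain driven by the interarrival times. It regenerates whenever a job finds the server idle,
so long-run averages are ratios of cycle expectations.

Charge each job the latency it adds if nobody else joins the batch being collected (`stateLatency`).
The charges telescope to the true total at every cycle start. With V = γ(r² + 1[q ≠ 0] τ(q)²) +
2βλqr, the expected increment of V cancels the part of the charge that depends on r and on q
linearly. Matching coefficients forces γ = λ/2 + βλ² and β(1 - λ²α²) = α + λα²/2. What remains is
`latencyRate`, an affine function of `stateWork`, the processing time a job adds: α, plus τ₀ if it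
opens a new batch. Hence E[W] ≤ A + γτ₀·w/e, where A = τ₀ + β + γατ₀ and w, e are the expected work
and number of jobs per cycle.

The two bounds are two estimates of w/e: a job adds at most α + τ₀ (giving φ₀), and the server
cannot do more than one unit of work per unit of time, so w/e ≤ 1/λ (giving φ₁). The comparison of
φ₀ with φ₁ is then that of α + τ₀ with 1/λ.

Carrying lemmas: `consistent_state` (pathwise identification), `measure_inter_nextCycle`
(independence of cycles), `tsum_expectAlive_le_of_hasDerivAt` (drift criterion),
`tsum_expectAlive_one_ne_top` (finite mean cycle) and `tsum_expectAlive_stateLatency_le` (the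
quadratic V). -/

open scoped ENNReal

/-! ### The Markov chain seen at arrivals. -/

namespace BatchQueue

/-- The number of waiting jobs and the residual processing time just after an arrival, as a function
of their values `s` just after the preceding arrival and of the interarrival time `t`. The number
of waiting jobs is `0` if and only if the arriving job found the server idle. -/
noncomputable def step (τ : ℕ → ℝ) (s : ℕ × ℝ) (t : ℝ) : ℕ × ℝ :=
  if t ≤ s.2 then (s.1 + 1, s.2 - t)
  else if s.1 ≠ 0 ∧ t ≤ s.2 + τ s.1 then (1, s.2 + τ s.1 - t)
  else (0, τ 1)

/-- The state just after the `n`-th arrival following a job that found the server idle, where `x` is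
the sequence of interarrival times. -/
noncomputable def state (τ : ℕ → ℝ) (x : ℕ → ℝ) : ℕ → ℕ × ℝ
  | 0 => (0, τ 1)
  | n + 1 => step τ (state τ x n) (x n)

/-- The contribution to the total latency of a job that brings the system into state `s`, the
latency being charged as if no more jobs joined the batch that is being collected. -/
def stateLatency (τ : ℕ → ℝ) (s : ℕ × ℝ) : ℝ :=
  s.2 + s.1 * τ s.1 - (s.1 - 1 : ℕ) * τ (s.1 - 1)

/-- The state `s` after the arrival of job `n` is consistent with the batches, and the jobs up to
`n` have total latency `C` if no more jobs join the batch that is being collected. -/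
def Consistent (τ T : ℕ → ℝ) (n : ℕ) (s : ℕ × ℝ) (C : ℝ) : Prop :=
  ∃ k, (∀ j ≤ k, (batch τ T j).next ≤ (batch τ T k).next) ∧
    (batch τ T k).next + s.1 = n + 1 ∧
    (batch τ T k).finish τ = arrival T n + s.2 ∧
    ∑ i ∈ Finset.range (batch τ T k).next, departure τ T i
      + s.1 * ((batch τ T k).finish τ + τ s.1) - ∑ i ∈ Finset.range (n + 1), arrival T i = C ∧
    ∀ i < (batch τ T k).next, arrival T i ≤ departure τ T i

/-! ### Pathwise agreement of the chain with the batches. -/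

section Pathwise

variable {τ T : ℕ → ℝ} {n : ℕ} {q : ℕ} {r C : ℝ}

lemma arrival_succ (T : ℕ → ℝ) (n : ℕ) : arrival T (n + 1) = arrival T n + T (n + 1) := by
  simp [arrival, Finset.sum_range_succ]

lemma arrival_strictMono (hT : ∀ i, 0 < T i) : StrictMono (arrival T) :=
  strictMono_nat_of_lt_succ fun n => by rw [arrival_succ]; linarith [hT (n + 1)]

lemma numArrived_eq (hT : ∀ i, 0 < T i) {y : ℝ} (h1 : arrival T n ≤ y)
    (h2 : y < arrival T (n + 1)) : numArrived T y = n + 1 := by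
  have : {i : ℕ | arrival T i ≤ y} = ((Finset.range (n + 1) : Finset ℕ) : Set ℕ) := by
    ext i
    simp only [Set.mem_ofPred_eq, Finset.coe_range, Set.mem_Iio]
    constructor
    · intro h
      exact (arrival_strictMono hT).lt_iff_lt.1 (h.trans_lt h2)
    · intro h
      exact ((arrival_strictMono hT).monotone (by omega)).trans h1
  rw [numArrived, this, Set.ncard_coe_finset, Finset.card_range]

lemma departure_eq {k i : ℕ} (h1 : ∀ j < k, (batch τ T j).next ≤ i)
    (h2 : i < (batch τ T k).next) : departure τ T i = (batch τ T k).finish τ := by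
  have : batchOf τ T i = k := by
    refine le_antisymm (Nat.sInf_le h2) ?_
    by_contra! h
    have := Nat.sInf_mem (s := {k : ℕ | i < (batch τ T k).next}) ⟨k, h2⟩
    have h3 := h1 _ h
    simp only [Set.mem_ofPred_eq, batchOf] at this h3
    omega
  rw [departure, this]

lemma sum_departure_eq {k m : ℕ} (h1 : ∀ j < k, (batch τ T j).next ≤ m)
    (h2 : m ≤ (batch τ T k).next) :
    ∑ i ∈ Finset.range (batch τ T k).next, departure τ T i =
      ∑ i ∈ Finset.range m, departure τ T i
        + ((batch τ T k).next - m : ℕ) * (batch τ T k).finish τ := by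
  rw [← Finset.sum_range_add_sum_Ico _ h2]
  congr 1
  rw [Finset.sum_congr rfl (g := fun _ => (batch τ T k).finish τ), Finset.sum_const,
    Nat.card_Ico, nsmul_eq_mul]
  intro i hi
  rw [Finset.mem_Ico] at hi
  exact departure_eq (fun j hj => (h1 j hj).trans hi.1) hi.2

lemma Consistent.zero (hτ : ∀ b, 0 ≤ τ b) (hT : ∀ i, 0 < T i) : Consistent τ T 0 (0, τ 1) (τ 1) := by
  have h0 : arrival T 0 = T 0 := by simp [arrival]
  have h1 : max 0 (arrival T 0) = arrival T 0 := max_eq_right (by rw [h0]; exact (hT 0).le)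
  have hn : (batch τ T 0).next = 1 := by
    simp only [batch, formBatch, h1]
    exact numArrived_eq hT le_rfl (arrival_strictMono hT (by norm_num))
  have hf : (batch τ T 0).finish τ = arrival T 0 + τ 1 := by
    have : (batch τ T 0).size = 1 := by rw [Batch.size, hn]; simp [batch, formBatch]
    rw [Batch.finish, this]
    simp [batch, formBatch, h1]
  refine ⟨0, fun j hj => by simp [Nat.le_zero.1 hj], by simp [hn], hf, ?_, ?_⟩
  · rw [sum_departure_eq (m := 0) (by simp) (by simp), hn, hf]
    simp
  · intro i hi
    rw [departure_eq (k := 0) (by simp) hi, hf]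
    obtain rfl : i = 0 := by omega
    linarith [hτ 1]

/-- The batch in service is unaffected. The newcomer waits out the residual time, and the collected
batch's processing charge rises from q τ(q) to (q + 1) τ(q + 1); `stateLatency` is exactly this
increment. -/
lemma Consistent.wait (h : Consistent τ T n (q, r) C) :
    Consistent τ T (n + 1) (q + 1, r - T (n + 1))
      (C + stateLatency τ (q + 1, r - T (n + 1))) := by
  obtain ⟨k, h1, h2, h3, h4, h5⟩ := h
  refine ⟨k, h1, by simp at h2 ⊢; omega, ?_, ?_, h5⟩
  · rw [h3, arrival_succ]; simp
  · rw [← h4, Finset.sum_range_succ _ (n + 1), arrival_succ, stateLatency, h3]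
    simp only [Nat.add_sub_cancel]
    push_cast
    ring

/-- An intermediate state between two arrivals: the collected batch enters service, and the residual
time is still measured from arrival `n`. `C` is unchanged because the batch was already charged at
its present size. The later cases of `step` thereby reduce to `wait` and `idle`. -/
lemma Consistent.form (hτ : ∀ b, 0 ≤ τ b) (hT : ∀ i, 0 < T i) (hq : q ≠ 0) (hr : 0 ≤ r)
    (hr' : r < T (n + 1))
    (h : Consistent τ T n (q, r) C) : Consistent τ T n (0, r + τ q) C := by
  obtain ⟨k, h1, h2, h3, h4, h5⟩ := h
  simp only at h2 h3 h4
  have hm : arrival T (batch τ T k).next ≤ arrival T n :=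
    (arrival_strictMono hT).monotone (by omega)
  have hmax : max ((batch τ T k).finish τ) (arrival T (batch τ T k).next)
      = (batch τ T k).finish τ := max_eq_left (by linarith)
  have hn : (batch τ T (k + 1)).next = n + 1 := by
    simp only [batch, formBatch, hmax]
    exact numArrived_eq hT (by linarith) (by rw [arrival_succ]; linarith)
  have hf : (batch τ T (k + 1)).finish τ = arrival T n + r + τ q := by
    have : (batch τ T (k + 1)).size = q := by
      rw [Batch.size, hn]; simp only [batch, formBatch]; omega
    rw [Batch.finish, this]
    simp only [batch, formBatch, hmax]
    rw [h3]
  refine ⟨k + 1, ?_, by simp [hn], by rw [hf]; ring, ?_, ?_⟩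
  · intro j hj
    rcases Nat.le_succ_iff.1 hj with hj | rfl
    · exact (h1 j hj).trans (by omega)
    · exact le_rfl
  · rw [sum_departure_eq (m := (batch τ T k).next) (fun j hj => h1 j (by omega)) (by omega),
      ← h4, hf, hn, h3, show n + 1 - (batch τ T k).next = q by omega]
    push_cast
    ring
  · intro i hi
    rcases lt_or_ge i (batch τ T k).next with h | h
    · exact h5 i h
    · rw [departure_eq (fun j hj => (h1 j (by omega)).trans h) hi, hf]
      have := (arrival_strictMono hT).monotone (show i ≤ n by omega)
      linarith [hτ q]

lemma Consistent.idle (hτ : ∀ b, 0 ≤ τ b) (hT : ∀ i, 0 < T i) (hr' : r < T (n + 1))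
    (h : Consistent τ T n (0, r) C) : Consistent τ T (n + 1) (0, τ 1) (C + τ 1) := by
  obtain ⟨k, h1, h2, h3, h4, h5⟩ := h
  simp only [add_zero] at h2 h3 h4
  have hmax : max ((batch τ T k).finish τ) (arrival T (batch τ T k).next)
      = arrival T (n + 1) := by
    rw [h2, max_eq_right]; rw [h3, arrival_succ]; linarith
  have hn : (batch τ T (k + 1)).next = n + 2 := by
    simp only [batch, formBatch, hmax]
    exact numArrived_eq hT le_rfl (arrival_strictMono hT (by omega))
  have hf : (batch τ T (k + 1)).finish τ = arrival T (n + 1) + τ 1 := by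
    have : (batch τ T (k + 1)).size = 1 := by
      rw [Batch.size, hn]; simp only [batch, formBatch]; omega
    rw [Batch.finish, this]
    simp only [batch, formBatch, hmax]
  refine ⟨k + 1, ?_, by simp [hn], hf, ?_, ?_⟩
  · intro j hj
    rcases Nat.le_succ_iff.1 hj with hj | rfl
    · exact (h1 j hj).trans (by omega)
    · exact le_rfl
  · rw [sum_departure_eq (m := (batch τ T k).next) (fun j hj => h1 j (by omega)) (by omega),
      ← h4, hf, hn, h2, Finset.sum_range_succ _ (n + 1), show n + 2 - (n + 1) = 1 by omega]
    push_cast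
    ring
  · intro i hi
    rcases lt_or_ge i (batch τ T k).next with h | h
    · exact h5 i h
    · rw [departure_eq (fun j hj => (h1 j (by omega)).trans h) hi, hf]
      have := (arrival_strictMono hT).monotone (show i ≤ n + 1 by omega)
      linarith [hτ 1]

lemma stateLatency_fresh (τ : ℕ → ℝ) (r : ℝ) : stateLatency τ (0, r) = r := by
  simp [stateLatency]

lemma Consistent.step (hτ : ∀ b, 0 ≤ τ b)
    (hT : ∀ i, 0 < T i) {s : ℕ × ℝ} (hr : 0 ≤ s.2)
    (h : Consistent τ T n s C) :
    Consistent τ T (n + 1) (step τ s (T (n + 1)))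
      (C + stateLatency τ (step τ s (T (n + 1)))) := by
  obtain ⟨q, r⟩ := s
  simp only [BatchQueue.step]
  simp only at hr
  split_ifs with h1 h2
  · exact h.wait
  · have := (h.form hτ hT h2.1 hr (not_le.1 h1)).wait
    simpa using this
  · rw [stateLatency_fresh]
    rcases eq_or_ne q 0 with rfl | hq
    · exact h.idle hτ hT (not_le.1 h1)
    · exact (h.form hτ hT hq hr (not_le.1 h1)).idle hτ hT (by
        by_contra! h3; exact h2 ⟨hq, h3⟩)

end Pathwise

/-! ### Regeneration of the chain and the work balance. -/

lemma step_nonneg {τ : ℕ → ℝ} (hτ : ∀ b, 0 ≤ τ b) (s : ℕ × ℝ) (t : ℝ) : 0 ≤ (step τ s t).2 := by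
  unfold step
  split_ifs with h1 h2
  · simpa using h1
  · simpa using h2.2
  · exact hτ 1

lemma state_nonneg {τ : ℕ → ℝ} (hτ : ∀ b, 0 ≤ τ b) (x : ℕ → ℝ) (n : ℕ) :
    0 ≤ (state τ x n).2 := by
  cases n with
  | zero => exact hτ 1
  | succ n => exact step_nonneg hτ _ _

lemma snd_step_of_fst_eq_zero {τ : ℕ → ℝ} {s : ℕ × ℝ} {t : ℝ} (h : (step τ s t).1 = 0) :
    step τ s t = (0, τ 1) := by
  unfold step at h ⊢
  split_ifs at h ⊢
  simp_all

lemma state_of_fst_eq_zero {τ x : ℕ → ℝ} {n : ℕ} (h : (state τ x n).1 = 0) :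
    state τ x n = (0, τ 1) := by
  cases n with
  | zero => rfl
  | succ n => exact snd_step_of_fst_eq_zero h

lemma state_add {τ x : ℕ → ℝ} {m : ℕ} (h : (state τ x m).1 = 0) (n : ℕ) :
    state τ x (m + n) = state τ (fun i => x (m + i)) n := by
  induction n with
  | zero => exact state_of_fst_eq_zero h
  | succ n ih => rw [← add_assoc, state, state, ih]

lemma consistent_state {τ T : ℕ → ℝ} (hτ : ∀ b, 0 ≤ τ b) (hT : ∀ i, 0 < T i) (n : ℕ) :
    Consistent τ T n (state τ (fun i => T (i + 1)) n)
      (∑ i ∈ Finset.range (n + 1), stateLatency τ (state τ (fun i => T (i + 1)) i)) := by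
  induction n with
  | zero => simpa [state, stateLatency_fresh] using Consistent.zero hτ hT
  | succ n ih =>
    rw [Finset.sum_range_succ _ (n + 1)]
    exact ih.step hτ hT (state_nonneg hτ _ n)

/-- When a job finds the server idle no batch is being collected, so every provisional charge has
become an actual latency. -/
lemma sum_latency_of_fresh {τ T : ℕ → ℝ} (hτ : ∀ b, 0 ≤ τ b) (hT : ∀ i, 0 < T i) {n : ℕ}
    (hn : (state τ (fun i => T (i + 1)) n).1 = 0) :
    ∑ i ∈ Finset.range (n + 1), latency τ T i =
      ∑ i ∈ Finset.range (n + 1), stateLatency τ (state τ (fun i => T (i + 1)) i) := by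
  obtain ⟨k, -, h2, -, h4, -⟩ := consistent_state hτ hT n
  rw [← h4, hn]
  rw [hn, add_zero] at h2
  simp [latency, h2]

lemma latency_nonneg_of_fresh {τ T : ℕ → ℝ} (hτ : ∀ b, 0 ≤ τ b) (hT : ∀ i, 0 < T i) {n i : ℕ}
    (hn : (state τ (fun i => T (i + 1)) n).1 = 0) (hi : i ≤ n) : 0 ≤ latency τ T i := by
  obtain ⟨k, -, h2, -, -, h5⟩ := consistent_state hτ hT n
  rw [hn, add_zero] at h2
  exact sub_nonneg.2 (h5 i (by omega))

/-- The processing time that is added to the system by a job that brings it into state `s`. -/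
noncomputable def stateWork (α τ₀ : ℝ) (s : ℕ × ℝ) : ℝ := α + if s.1 ≤ 1 then τ₀ else 0

/-- Work conservation: all work brought in is either still present (in service or collected) or was
done in the elapsed time, at unit speed at most. Idle time accounts for the inequality. -/
lemma sum_stateWork_le {α τ₀ : ℝ} {x : ℕ → ℝ} (hα : 0 ≤ α) (hτ₀ : 0 ≤ τ₀) (hx : ∀ i, 0 ≤ x i)
    (n : ℕ) :
    ∑ i ∈ Finset.range (n + 1), stateWork α τ₀ (state (linearTime α τ₀) x i) ≤
      (state (linearTime α τ₀) x n).2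
        + (if (state (linearTime α τ₀) x n).1 = 0 then 0
            else linearTime α τ₀ (state (linearTime α τ₀) x n).1)
        + ∑ i ∈ Finset.range n, x i := by
  have hτ : ∀ b, 0 ≤ linearTime α τ₀ b := fun b => by unfold linearTime; positivity
  induction n with
  | zero => simp [state, stateWork, linearTime]
  | succ n ih =>
    rw [Finset.sum_range_succ _ (n + 1), Finset.sum_range_succ x n]
    generalize ∑ i ∈ Finset.range (n + 1), stateWork α τ₀ _ = G at *
    generalize ∑ i ∈ Finset.range n, x i = X at *
    have hr := state_nonneg hτ x n
    have hx := hx n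
    rw [state]
    generalize state (linearTime α τ₀) x n = s at *
    obtain ⟨q, r⟩ := s
    simp only at ih hr
    unfold step
    split_ifs at ih ⊢ with h1 h2 h3 h4 <;>
      simp_all [stateWork, linearTime] <;> nlinarith

/-! ### Independent cycles and the strong law. -/

section Cycle

variable {τ : ℕ → ℝ}

lemma measurable_step (τ : ℕ → ℝ) : Measurable (fun p : (ℕ × ℝ) × ℝ => step τ p.1 p.2) := by
  have h : Measurable τ := measurable_from_nat
  unfold step
  refine Measurable.ite ?_ ?_ (Measurable.ite ?_ ?_ ?_)
  · exact measurableSet_le measurable_snd (measurable_snd.comp measurable_fst)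
  · fun_prop
  · refine MeasurableSet.inter ?_ ?_
    · exact (measurable_fst.comp measurable_fst) (MeasurableSet.of_discrete (s := {q : ℕ | q ≠ 0}))
    · exact measurableSet_le measurable_snd (by fun_prop)
  · fun_prop
  · fun_prop

/-- The σ-algebra generated by the first `n` coordinates of a sequence. -/
abbrev past (n : ℕ) : MeasurableSpace (ℕ → ℝ) :=
  ⨆ i ∈ Set.Iio n, MeasurableSpace.comap (fun x : ℕ → ℝ => x i) inferInstance

lemma past_le (n : ℕ) : past n ≤ (inferInstance : MeasurableSpace (ℕ → ℝ)) :=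
  iSup₂_le fun i _ => (measurable_pi_apply i).comap_le

lemma measurable_past_apply {i n : ℕ} (h : i < n) : Measurable[past n] (fun x : ℕ → ℝ => x i) := by
  rw [measurable_iff_comap_le]
  exact le_iSup₂_of_le i h le_rfl

lemma measurable_past_state (τ : ℕ → ℝ) {m n : ℕ} (h : m ≤ n) :
    Measurable[past n] (fun x => state τ x m) := by
  induction m with
  | zero => exact measurable_const
  | succ m ih =>
    exact (measurable_step τ).comp ((ih (by omega)).prodMk (measurable_past_apply (by omega)))

lemma measurable_state (τ : ℕ → ℝ) (n : ℕ) : Measurable (fun x => state τ x n) :=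
  (measurable_past_state τ le_rfl).mono (past_le n) le_rfl

/-- The number of jobs in the first cycle: the index of the first job after job `0` that finds the
server idle. -/
noncomputable def cycleLength (τ x : ℕ → ℝ) : ℕ := sInf {n | 0 < n ∧ (state τ x n).1 = 0}

/-- The sequence of interarrival times from the end of the first cycle on. -/
noncomputable def nextCycle (τ x : ℕ → ℝ) : ℕ → ℝ := fun i => x (cycleLength τ x + i)

/-- The total of `f` over the states at the arrivals of the first cycle. -/
noncomputable def cycleSum (τ : ℕ → ℝ) (f : ℕ × ℝ → ℝ) (x : ℕ → ℝ) : ℝ :=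
  ∑ i ∈ Finset.range (cycleLength τ x), f (state τ x i)

/-- The sequences of interarrival times for which the first cycle ends. -/
def Ends (τ x : ℕ → ℝ) : Prop := ∃ n, 0 < n ∧ (state τ x n).1 = 0

lemma Ends.spec {x : ℕ → ℝ} (h : Ends τ x) :
    0 < cycleLength τ x ∧ (state τ x (cycleLength τ x)).1 = 0 := Nat.sInf_mem h

lemma cycleLength_eq_iff {x : ℕ → ℝ} {n : ℕ} (hn : 0 < n) :
    cycleLength τ x = n ↔ (state τ x n).1 = 0 ∧ ∀ i < n, 0 < i → (state τ x i).1 ≠ 0 := by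
  constructor
  · intro h
    have hne : Ends τ x := by
      by_contra hE
      have : {n | 0 < n ∧ (state τ x n).1 = 0} = ∅ := by
        ext m; simp only [Set.mem_ofPred_eq, Set.mem_empty_iff_false, iff_false]
        exact fun hm => hE ⟨m, hm⟩
      rw [cycleLength, this, Nat.sInf_empty] at h
      omega
    refine ⟨h ▸ hne.spec.2, fun i hi h0 h1 => ?_⟩
    have : cycleLength τ x ≤ i := Nat.sInf_le ⟨h0, h1⟩
    omega
  · rintro ⟨h1, h2⟩
    have hne : Ends τ x := ⟨n, hn, h1⟩
    refine le_antisymm (Nat.sInf_le ⟨hn, h1⟩) ?_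
    by_contra! h
    exact h2 _ h hne.spec.1 hne.spec.2

/-- The cycle length is a stopping time: the state at job `n` depends only on coordinates below `n`.
-/
lemma measurableSet_past_cycleLength_eq {n : ℕ} (hn : 0 < n) :
    MeasurableSet[past n] {x | cycleLength τ x = n} := by
  simp_rw [cycleLength_eq_iff hn]
  have key : ∀ i ≤ n, MeasurableSet[past n] {x | (state τ x i).1 = 0} := fun i hi =>
    (measurable_fst.comp (measurable_past_state τ hi)) (measurableSet_singleton 0)
  have : {x : ℕ → ℝ | ∀ i < n, 0 < i → (state τ x i).1 ≠ 0} =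
      ⋂ i, ⋂ (_ : i < n), ⋂ (_ : 0 < i), {x | (state τ x i).1 = 0}ᶜ := by
    ext; simp
  suffices h : MeasurableSet[past n] {x : ℕ → ℝ | ∀ i < n, 0 < i → (state τ x i).1 ≠ 0} from
    (key n le_rfl).inter h
  rw [this]
  exact MeasurableSet.iInter fun i => MeasurableSet.iInter fun hi => MeasurableSet.iInter fun _ =>
    (key i hi.le).compl

lemma measurable_cycleLength (τ : ℕ → ℝ) : Measurable (cycleLength τ) := by
  have key : ∀ n, 0 < n → MeasurableSet {x | cycleLength τ x = n} := fun n hn =>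
    past_le n _ (measurableSet_past_cycleLength_eq hn)
  refine measurable_to_countable' fun n => ?_
  rcases Nat.eq_zero_or_pos n with rfl | hn
  · have : cycleLength τ ⁻¹' {0} = (⋃ n, ⋃ (_ : 0 < n), {x | cycleLength τ x = n})ᶜ := by
      ext x
      simp only [Set.mem_preimage, Set.mem_singleton_iff, Set.mem_compl_iff, Set.mem_iUnion,
        Set.mem_ofPred_eq]
      constructor
      · rintro h ⟨n, hn, h'⟩; omega
      · intro h; by_contra h'; exact h ⟨_, Nat.pos_of_ne_zero h', rfl⟩
    rw [this]
    exact (MeasurableSet.iUnion fun n => MeasurableSet.iUnion fun hn => key n hn).compl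
  · exact key n hn

lemma measurable_nextCycle (τ : ℕ → ℝ) : Measurable (nextCycle τ) := by
  refine measurable_pi_lambda _ fun i => ?_
  have : Measurable (fun p : ℕ × (ℕ → ℝ) => p.2 (p.1 + i)) :=
    measurable_from_prod_countable_right fun n => measurable_pi_apply (n + i)
  exact this.comp ((measurable_cycleLength τ).prodMk measurable_id)

lemma measurable_cycleSum {f : ℕ × ℝ → ℝ} (hf : Measurable f) : Measurable (cycleSum τ f) := by
  have : Measurable (fun p : ℕ × (ℕ → ℝ) => ∑ i ∈ Finset.range p.1, f (state τ p.2 i)) :=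
    measurable_from_prod_countable_right fun n =>
      Finset.measurable_fun_sum (Finset.range n) fun i _ => hf.comp (measurable_state τ i)
  exact this.comp ((measurable_cycleLength τ).prodMk measurable_id)

variable (η : Measure ℝ) [IsProbabilityMeasure η]

/-- The law of a sequence of independent random variables with law `η`. -/
noncomputable def iidLaw : Measure (ℕ → ℝ) := Measure.infinitePi (fun _ : ℕ => η)

instance : IsProbabilityMeasure (iidLaw η) := by unfold iidLaw; infer_instance

lemma iIndepFun_iidLaw : iIndepFun (fun (i : ℕ) (x : ℕ → ℝ) => x i) (iidLaw η) :=
  iIndepFun_infinitePi (P := fun _ : ℕ => η) (X := fun _ => id) fun _ => measurable_id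

lemma map_eval_iidLaw (i : ℕ) : (iidLaw η).map (fun x => x i) = η :=
  Measure.infinitePi_map_eval (fun _ : ℕ => η) i

lemma indep_past_future (n : ℕ) : Indep (past n)
    (⨆ i ∈ Set.Ici n, MeasurableSpace.comap (fun x : ℕ → ℝ => x i) inferInstance) (iidLaw η) :=
  indep_iSup_of_disjoint (fun i => (measurable_pi_apply i).comap_le) (iIndepFun_iidLaw η)
    (Set.disjoint_left.2 fun i (h1 : i < n) (h2 : n ≤ i) => not_lt.2 h2 h1)

lemma measurePreserving_shift (n : ℕ) :
    MeasurePreserving (fun (x : ℕ → ℝ) i => x (n + i)) (iidLaw η) (iidLaw η) :=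
  ⟨by fun_prop, Measure.map_infinitePi_infinitePi_of_inj (P := fun _ : ℕ => η)
    (f := fun i => n + i) (fun a b h => by simpa using h)⟩

lemma measure_inter_shift {n : ℕ} {A B : Set (ℕ → ℝ)} (hA : MeasurableSet[past n] A)
    (hB : MeasurableSet B) :
    iidLaw η (A ∩ (fun (x : ℕ → ℝ) i => x (n + i)) ⁻¹' B) = iidLaw η A * iidLaw η B := by
  rw [(Indep_iff _ _ _).1 (indep_past_future η n) _ _ hA,
    (measurePreserving_shift η n).measure_preimage hB.nullMeasurableSet]
  refine (@measurable_pi_lambda _ _ _ (⨆ i ∈ Set.Ici n,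
    MeasurableSpace.comap (fun x : ℕ → ℝ => x i) inferInstance) _ _ fun i => ?_) hB
  rw [measurable_iff_comap_le]
  exact le_iSup₂_of_le (n + i) (by simp) le_rfl

/-- The next interarrival time is independent of the past, so it can be integrated out with the past
frozen. -/
lemma lintegral_past_apply {β : Type*} [MeasurableSpace β] {n : ℕ} {g : (ℕ → ℝ) → β}
    (hg : Measurable[past n] g) {f : β × ℝ → ℝ≥0∞} (hf : Measurable f) :
    ∫⁻ x, f (g x, x n) ∂(iidLaw η) = ∫⁻ x, ∫⁻ t, f (g x, t) ∂η ∂(iidLaw η) := by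
  have hg' : Measurable g := hg.mono (past_le n) le_rfl
  have hind : IndepFun g (fun x : ℕ → ℝ => x n) (iidLaw η) := by
    rw [IndepFun_iff_Indep]
    refine indep_of_indep_of_le_left (indep_of_indep_of_le_right (indep_past_future η n) ?_)
      hg.comap_le
    exact le_iSup₂_of_le n (by simp) le_rfl
  rw [indepFun_iff_map_prod_eq_prod_map_map hg'.aemeasurable
    (measurable_pi_apply n).aemeasurable, map_eval_iidLaw] at hind
  rw [← lintegral_map (f := f) hf (hg'.prodMk (measurable_pi_apply n)), hind,
    lintegral_prod _ hf.aemeasurable, lintegral_map hf.lintegral_prod_right' hg']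

variable {η}

omit [IsProbabilityMeasure η] in
lemma measure_eq_tsum_cycleLength (hE : ∀ᵐ x ∂(iidLaw η), Ends τ x) {A : Set (ℕ → ℝ)}
    (hA : MeasurableSet A) : iidLaw η A = ∑' n : ℕ, iidLaw η (A ∩ {x | cycleLength τ x = n + 1}) := by
  have hm : ∀ n : ℕ, MeasurableSet {x | cycleLength τ x = n + 1} := fun n =>
    (measurable_cycleLength τ) (measurableSet_singleton (n + 1))
  have hd : Pairwise (Function.onFun Disjoint fun n : ℕ => {x | cycleLength τ x = n + 1}) := by
    intro m n hmn
    rw [Function.onFun, Set.disjoint_left]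
    intro x h1 h2
    simp only [Set.mem_ofPred_eq] at h1 h2
    omega
  rw [← measure_iUnion (fun m n hmn => (hd hmn).mono Set.inter_subset_right
    Set.inter_subset_right) fun n => hA.inter (hm n), ← Set.inter_iUnion]
  refine measure_congr ?_
  filter_upwards [hE] with x hx
  refine propext (Iff.symm (and_iff_left ?_))
  exact Set.mem_iUnion.2 ⟨cycleLength τ x - 1, (Nat.sub_add_cancel hx.spec.1).symm⟩

/-- The strong Markov property at the end of the first cycle: on each event of given cycle length,
`nextCycle` is a deterministic shift and the cycle sum is determined by the past. -/
lemma measure_inter_nextCycle (hE : ∀ᵐ x ∂(iidLaw η), Ends τ x) {f : ℕ × ℝ → ℝ} (hf : Measurable f)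
    {A : Set ℝ} (hA : MeasurableSet A) {B : Set (ℕ → ℝ)} (hB : MeasurableSet B) :
    iidLaw η (cycleSum τ f ⁻¹' A ∩ nextCycle τ ⁻¹' B) =
      iidLaw η (cycleSum τ f ⁻¹' A) * iidLaw η B := by
  have hA' := measurable_cycleSum (τ := τ) hf hA
  rw [measure_eq_tsum_cycleLength hE (hA'.inter (measurable_nextCycle τ hB)),
    measure_eq_tsum_cycleLength hE hA', ← ENNReal.tsum_mul_right]
  congr 1 with n
  rw [← measure_inter_shift η (n := n + 1) _ hB]
  · congr 1
    ext x
    simp only [Set.mem_inter_iff, Set.mem_preimage, Set.mem_ofPred_eq]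
    constructor
    · rintro ⟨⟨h1, h2⟩, h3⟩
      refine ⟨⟨h1, h3⟩, ?_⟩
      have e : nextCycle τ x = fun i => x (n + 1 + i) := by funext i; rw [nextCycle, h3]
      rwa [e] at h2
    · rintro ⟨⟨h1, h3⟩, h2⟩
      refine ⟨⟨h1, ?_⟩, h3⟩
      have e : nextCycle τ x = fun i => x (n + 1 + i) := by funext i; rw [nextCycle, h3]
      rwa [e]
  · have : cycleSum τ f ⁻¹' A ∩ {x | cycleLength τ x = n + 1} =
        (fun x => ∑ i ∈ Finset.range (n + 1), f (state τ x i)) ⁻¹' A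
          ∩ {x | cycleLength τ x = n + 1} := by
      ext x
      simp only [Set.mem_inter_iff, Set.mem_preimage, Set.mem_ofPred_eq, cycleSum]
      constructor <;> rintro ⟨h1, h2⟩ <;> simp_all
    rw [this]
    refine MeasurableSet.inter ?_ (measurableSet_past_cycleLength_eq (Nat.succ_pos n))
    refine (Finset.measurable_sum _ fun i hi => hf.comp (measurable_past_state τ ?_)) hA
    exact (Finset.mem_range.1 hi).le

lemma measurePreserving_nextCycle (hE : ∀ᵐ x ∂(iidLaw η), Ends τ x) :
    MeasurePreserving (nextCycle τ) (iidLaw η) (iidLaw η) := by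
  refine ⟨measurable_nextCycle τ, Measure.ext fun B hB => ?_⟩
  rw [Measure.map_apply (measurable_nextCycle τ) hB]
  simpa using measure_inter_nextCycle hE (f := 0) measurable_const MeasurableSet.univ hB

lemma indepFun_cycleSum_nextCycle (hE : ∀ᵐ x ∂(iidLaw η), Ends τ x) {f : ℕ × ℝ → ℝ}
    (hf : Measurable f) : IndepFun (cycleSum τ f) (nextCycle τ) (iidLaw η) := by
  rw [indepFun_iff_measure_inter_preimage_eq_mul]
  intro A B hA hB
  rw [measure_inter_nextCycle hE hf hA hB,
    (measurePreserving_nextCycle hE).measure_preimage hB.nullMeasurableSet]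

/-- The averages of an additive functional of the states over the cycles converge. -/
lemma tendsto_cycleSum (hE : ∀ᵐ x ∂(iidLaw η), Ends τ x) {f : ℕ × ℝ → ℝ} (hf : Measurable f)
    (hint : Integrable (cycleSum τ f) (iidLaw η)) :
    ∀ᵐ x ∂(iidLaw η), Tendsto
      (fun n : ℕ => (∑ i ∈ Finset.range n, cycleSum τ f ((nextCycle τ)^[i] x)) / n) atTop
      (𝓝 (∫ x, cycleSum τ f x ∂(iidLaw η))) := by
  have hS := measurePreserving_nextCycle hE
  have hm := measurable_cycleSum (τ := τ) hf
  have hlt : ∀ i j, i < j → IndepFun (fun x => cycleSum τ f ((nextCycle τ)^[i] x))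
      (fun x => cycleSum τ f ((nextCycle τ)^[j] x)) (iidLaw η) := by
    intro i j hij
    -- Since `nextCycle` preserves the law, the independence of the first cycle and cycle `k + 1`
    -- pulls back along `i` iterates to cycles `i` and `i + k + 1`.
    obtain ⟨k, rfl⟩ := Nat.exists_eq_add_of_lt hij
    have h0 : IndepFun (cycleSum τ f)
        ((fun x => cycleSum τ f ((nextCycle τ)^[k] x)) ∘ nextCycle τ) (iidLaw η) :=
      (indepFun_cycleSum_nextCycle hE hf).comp measurable_id
        (hm.comp (hS.measurable.iterate k))
    rw [indepFun_iff_measure_inter_preimage_eq_mul] at h0 ⊢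
    intro A B hA hB
    have hA' := hm hA
    have hB' := (hm.comp ((hS.measurable.iterate k).comp hS.measurable)) hB
    have e1 := (hS.iterate i).measure_preimage hA'.nullMeasurableSet
    have e2 := (hS.iterate i).measure_preimage hB'.nullMeasurableSet
    have e3 := (hS.iterate i).measure_preimage (hA'.inter hB').nullMeasurableSet
    have e4 : ∀ x, (nextCycle τ)^[i + k + 1] x
        = (nextCycle τ)^[k] (nextCycle τ ((nextCycle τ)^[i] x)) := fun x => by
      rw [show i + k + 1 = k + (1 + i) by ring, Function.iterate_add_apply,
        Function.iterate_add_apply, Function.iterate_one]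
    simp_rw [e4]
    have h1 := h0 A B hA hB
    refine (e3.trans h1).trans ?_
    rw [← e1]
    congr 1
    exact e2.symm
  refine strong_law_ae_real (fun i x => cycleSum τ f ((nextCycle τ)^[i] x)) hint ?_ ?_
  · intro i j hij
    rcases lt_or_gt_of_ne hij with h | h
    · exact hlt i j h
    · exact (hlt j i h).symm
  · intro i
    refine ⟨(hm.comp (hS.measurable.iterate i)).aemeasurable, hm.aemeasurable, ?_⟩
    have := (hS.iterate i).map_eq
    conv_rhs => rw [Function.iterate_zero]; simp only [id]; rw [← this]
    rw [Measure.map_map hm (hS.measurable.iterate i)]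
    rfl

end Cycle

/-! ### Drift inequalities for the chain killed at the end of a cycle. -/

section Drift

variable {τ : ℕ → ℝ}

/-- The indicator that none of the jobs `1, …, n` finds the server idle. -/
noncomputable def alive (τ : ℕ → ℝ) (n : ℕ) (x : ℕ → ℝ) : ℝ≥0∞ :=
  ∏ i ∈ Finset.range n, if (state τ x (i + 1)).1 = 0 then 0 else 1

/-- `F` at the state after the next arrival, or `0` if the arriving job finds the server idle. -/
noncomputable def killedStep (τ : ℕ → ℝ) (F : ℕ × ℝ → ℝ≥0∞) (s : ℕ × ℝ) (t : ℝ) : ℝ≥0∞ :=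
  if (step τ s t).1 = 0 then 0 else F (step τ s t)

lemma measurable_past_alive (τ : ℕ → ℝ) (n : ℕ) : Measurable[past n] (alive τ n) := by
  have hf : Measurable fun s : ℕ × ℝ => if s.1 = 0 then (0 : ℝ≥0∞) else 1 :=
    (measurable_of_countable fun q : ℕ => if q = 0 then (0 : ℝ≥0∞) else 1).comp measurable_fst
  refine Finset.measurable_fun_prod _ fun i hi => ?_
  exact hf.comp (measurable_past_state τ (Finset.mem_range.1 hi))

lemma measurable_alive (τ : ℕ → ℝ) (n : ℕ) : Measurable (alive τ n) :=
  (measurable_past_alive τ n).mono (past_le n) le_rfl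

lemma alive_succ_mul (n : ℕ) (x : ℕ → ℝ) (F : ℕ × ℝ → ℝ≥0∞) :
    alive τ (n + 1) x * F (state τ x (n + 1)) =
      alive τ n x * killedStep τ F (state τ x n) (x n) := by
  rw [alive, Finset.prod_range_succ, mul_assoc, killedStep, ← state]
  simp only [alive, ite_mul, zero_mul, one_mul]

lemma alive_eq {x : ℕ → ℝ} (h : Ends τ x) (n : ℕ) :
    alive τ n x = if n < cycleLength τ x then 1 else 0 := by
  split_ifs with hn
  · refine Finset.prod_eq_one fun i hi => if_neg fun h0 => ?_
    have : cycleLength τ x ≤ i + 1 := Nat.sInf_le ⟨Nat.succ_pos i, h0⟩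
    have := Finset.mem_range.1 hi
    omega
  · have := h.spec
    refine Finset.prod_eq_zero (i := cycleLength τ x - 1) (Finset.mem_range.2 (by omega)) ?_
    rw [Nat.sub_add_cancel (by omega), if_pos this.2]

lemma alive_of_not_ends {x : ℕ → ℝ} (h : ¬ Ends τ x) (n : ℕ) : alive τ n x = 1 :=
  Finset.prod_eq_one fun i _ => if_neg fun h0 => h ⟨i + 1, Nat.succ_pos i, h0⟩

lemma measurable_killedStep {F : ℕ × ℝ → ℝ≥0∞} (hF : Measurable F) :
    Measurable fun p : (ℕ × ℝ) × ℝ => killedStep τ F p.1 p.2 := by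
  refine Measurable.ite ?_ measurable_const (hF.comp (measurable_step τ))
  exact (measurable_fst.comp (measurable_step τ)) (measurableSet_singleton 0)

variable (η : Measure ℝ) [IsProbabilityMeasure η]

/-- The expectation of `F` at the state of job `n` on the event that none of the jobs `1, …, n`
finds the server idle. -/
noncomputable def expectAlive (τ : ℕ → ℝ) (F : ℕ × ℝ → ℝ≥0∞) (n : ℕ) : ℝ≥0∞ :=
  ∫⁻ x, alive τ n x * F (state τ x n) ∂(iidLaw η)

lemma expectAlive_zero (F : ℕ × ℝ → ℝ≥0∞) : expectAlive η τ F 0 = F (0, τ 1) := by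
  simp [expectAlive, alive, state]

lemma expectAlive_succ {F : ℕ × ℝ → ℝ≥0∞} (hF : Measurable F) (n : ℕ) :
    expectAlive η τ F (n + 1) = expectAlive η τ (fun s => ∫⁻ t, killedStep τ F s t ∂η) n := by
  simp_rw [expectAlive, alive_succ_mul]
  have hm : Measurable fun p : (ℝ≥0∞ × (ℕ × ℝ)) × ℝ => p.1.1 * killedStep τ F p.1.2 p.2 :=
    (measurable_fst.comp measurable_fst).mul ((measurable_killedStep hF).comp
      ((measurable_snd.comp measurable_fst).prodMk measurable_snd))
  refine (lintegral_past_apply η (g := fun x => (alive τ n x, state τ x n))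
    ((measurable_past_alive τ n).prodMk (measurable_past_state τ le_rfl)) hm).trans ?_
  refine lintegral_congr fun x => ?_
  exact lintegral_const_mul _ ((measurable_killedStep hF).comp measurable_prodMk_left)

omit [IsProbabilityMeasure η] in
lemma expectAlive_add {F G : ℕ × ℝ → ℝ≥0∞} (hF : Measurable F) (n : ℕ) :
    expectAlive η τ (fun s => F s + G s) n = expectAlive η τ F n + expectAlive η τ G n := by
  simp_rw [expectAlive, mul_add]
  exact lintegral_add_left ((measurable_alive τ n).mul (hF.comp (measurable_state τ n))) _

omit [IsProbabilityMeasure η] in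
lemma expectAlive_mono (hτ : ∀ b, 0 ≤ τ b) {F G : ℕ × ℝ → ℝ≥0∞}
    (h : ∀ s : ℕ × ℝ, 0 ≤ s.2 → F s ≤ G s) (n : ℕ) :
    expectAlive η τ F n ≤ expectAlive η τ G n :=
  lintegral_mono fun x => mul_le_mul_right (h _ (state_nonneg hτ x n)) _

/-- A drift inequality bounds the expected total of `p` over the first cycle. -/
lemma tsum_expectAlive_le (hτ : ∀ b, 0 ≤ τ b) {V p m : ℕ × ℝ → ℝ≥0∞} (hV : Measurable V)
    (hp : Measurable p) (hm : Measurable m)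
    (h : ∀ s : ℕ × ℝ, 0 ≤ s.2 → ∫⁻ t, killedStep τ (fun s => V s + p s) s t ∂η ≤
      V s + ∫⁻ t, killedStep τ m s t ∂η) :
    ∑' n, expectAlive η τ p (n + 1) ≤ V (0, τ 1) + ∑' n, expectAlive η τ m (n + 1) := by
  have hstep : ∀ n, expectAlive η τ V (n + 1) + expectAlive η τ p (n + 1) ≤
      expectAlive η τ V n + expectAlive η τ m (n + 1) := fun n => by
    rw [← expectAlive_add η hV, expectAlive_succ η (F := fun s => V s + p s) (hV.add hp), expectAlive_succ η hm,
      ← expectAlive_add η hV]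
    exact expectAlive_mono η hτ h n
  -- The drift inequality is telescoped with V kept on the left, as subtraction in `ℝ≥0∞` truncates.
  have hsum : ∀ N, expectAlive η τ V N + ∑ n ∈ Finset.range N, expectAlive η τ p (n + 1) ≤
      V (0, τ 1) + ∑ n ∈ Finset.range N, expectAlive η τ m (n + 1) := fun N => by
    induction N with
    | zero => simp [expectAlive_zero]
    | succ N ih =>
      rw [Finset.sum_range_succ, Finset.sum_range_succ]
      calc _ = (expectAlive η τ V (N + 1) + expectAlive η τ p (N + 1))
            + ∑ n ∈ Finset.range N, expectAlive η τ p (n + 1) := by ring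
        _ ≤ (expectAlive η τ V N + expectAlive η τ m (N + 1))
            + ∑ n ∈ Finset.range N, expectAlive η τ p (n + 1) := add_le_add_left (hstep N) _
        _ = (expectAlive η τ V N + ∑ n ∈ Finset.range N, expectAlive η τ p (n + 1))
            + expectAlive η τ m (N + 1) := by ring
        _ ≤ _ := by rw [← add_assoc]; gcongr
  rw [ENNReal.tsum_eq_iSup_nat]
  refine iSup_le fun N => le_add_self.trans ((hsum N).trans ?_)
  gcongr
  exact ENNReal.sum_le_tsum _

-- On a path whose cycle never ends every `alive` factor is 1, so the sum of these indicators
-- diverges there.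
omit [IsProbabilityMeasure η] in
lemma ae_ends_of_tsum_ne_top (h : ∑' n, expectAlive η τ (fun _ => 1) (n + 1) ≠ ∞) :
    ∀ᵐ x ∂(iidLaw η), Ends τ x := by
  simp only [expectAlive, mul_one] at h
  rw [← lintegral_tsum fun n => (measurable_alive τ (n + 1)).aemeasurable] at h
  filter_upwards [ae_lt_top (Measurable.tsum fun n => measurable_alive τ (n + 1)) h]
    with x hx
  by_contra hE
  simp [alive_of_not_ends hE] at hx

variable {η}

lemma lintegral_cycleSum (hE : ∀ᵐ x ∂(iidLaw η), Ends τ x) (hτ : ∀ b, 0 ≤ τ b) {f : ℕ × ℝ → ℝ}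
    (hf : Measurable f) (hf0 : ∀ s : ℕ × ℝ, 0 ≤ s.2 → 0 ≤ f s) :
    ∫⁻ x, ENNReal.ofReal (cycleSum τ f x) ∂(iidLaw η) = ENNReal.ofReal (f (0, τ 1)) +
      ∑' n, expectAlive η τ (fun s => ENNReal.ofReal (f s)) (n + 1) := by
  rw [← expectAlive_zero η (τ := τ) (fun s => ENNReal.ofReal (f s)), ← tsum_eq_zero_add']
  · simp only [expectAlive]
    have hm : ∀ n, AEMeasurable (fun x => alive τ n x * ENNReal.ofReal (f (state τ x n)))
        (iidLaw η) := fun n => ((measurable_alive τ n).mul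
      (hf.comp (measurable_state τ n)).ennreal_ofReal).aemeasurable
    rw [← lintegral_tsum hm]
    refine lintegral_congr_ae ?_
    filter_upwards [hE] with x hx
    rw [cycleSum, ENNReal.ofReal_sum_of_nonneg fun i _ => hf0 _ (state_nonneg hτ x i),
      tsum_eq_sum (s := Finset.range (cycleLength τ x))]
    · refine Finset.sum_congr rfl fun i hi => ?_
      rw [alive_eq hx, if_pos (Finset.mem_range.1 hi), one_mul]
    · intro i hi
      rw [alive_eq hx, if_neg (by simpa using hi), zero_mul]
  · exact ENNReal.summable

end Drift

/-! ### One-step expectations under exponential interarrival times. -/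

section Exponential

variable {lam : ℝ}

/-- The equation for `U` says that -exp(-λt) U(a + b - t) is an antiderivative of the integrand λ
exp(-λt) F(a + b - t). -/
lemma lintegral_expMeasure_Ioc (hlam : 0 < lam) {a b : ℝ} (ha : 0 ≤ a) (hb : 0 ≤ b) {F U : ℝ → ℝ}
    (hF : Continuous F) (hF0 : ∀ s, 0 ≤ s → 0 ≤ F s)
    (hU : ∀ s, HasDerivAt U (lam * (F s - U s)) s) :
    ∫⁻ t in Set.Ioc a (a + b), ENNReal.ofReal (F (a + b - t)) ∂(expMeasure lam) =
      ENNReal.ofReal (Real.exp (-(lam * a)) * (U b - Real.exp (-(lam * b)) * U 0)) := by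
  have h1 : expMeasure lam = volume.withDensity (exponentialPDF lam) := rfl
  have hpdf : Measurable (exponentialPDF lam) := (measurable_exponentialPDFReal lam).ennreal_ofReal
  rw [h1, restrict_withDensity measurableSet_Ioc, lintegral_withDensity_eq_lintegral_mul _ hpdf
    (by fun_prop)]
  have h2 : ∫⁻ t in Set.Ioc a (a + b), (exponentialPDF lam * fun t =>
      ENNReal.ofReal (F (a + b - t))) t = ∫⁻ t in Set.Ioc a (a + b),
        ENNReal.ofReal (lam * Real.exp (-(lam * t)) * F (a + b - t)) := by
    refine setLIntegral_congr_fun measurableSet_Ioc fun t ht => ?_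
    simp only [Pi.mul_apply]
    rw [exponentialPDF_of_nonneg (ha.trans ht.1.le), ← ENNReal.ofReal_mul (by positivity)]
  have hc : Continuous fun t => lam * Real.exp (-(lam * t)) * F (a + b - t) := by fun_prop
  rw [h2, ← ofReal_integral_eq_lintegral_ofReal]
  · congr 1
    rw [← intervalIntegral.integral_of_le (by linarith)]
    rw [intervalIntegral.integral_eq_sub_of_hasDerivAt
      (f := fun t => -(Real.exp (-(lam * t)) * U (a + b - t)))
      (fun t _ => ?_) (hc.intervalIntegrable _ _)]
    · have : Real.exp (-(lam * (a + b))) = Real.exp (-(lam * a)) * Real.exp (-(lam * b)) := by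
        rw [← Real.exp_add]; ring_nf
      simp only [sub_self, add_sub_cancel_left, this]
      ring
    · have e1 : HasDerivAt (fun t => Real.exp (-(lam * t))) (Real.exp (-(lam * t)) * (-lam)) t := by
        have := ((hasDerivAt_id t).const_mul lam).neg.exp
        simpa using this
      have e2 : HasDerivAt (fun t => U (a + b - t))
          (lam * (F (a + b - t) - U (a + b - t)) * (-1)) t :=
        (hU (a + b - t)).comp t ((hasDerivAt_id t).const_sub (a + b))
      refine (e1.mul e2).neg.congr_deriv ?_
      ring
  · exact (hc.intervalIntegrable a (a + b)).1
  · refine (ae_restrict_iff' measurableSet_Ioc).2 (Eventually.of_forall fun t ht => ?_)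
    have := hF0 (a + b - t) (by linarith [ht.2])
    positivity

lemma expMeasure_Iic_zero (hlam : 0 < lam) : expMeasure lam (Set.Iic 0) = 0 := by
  have h1 : expMeasure lam = volume.withDensity (exponentialPDF lam) := rfl
  rw [h1, withDensity_apply _ measurableSet_Iic, lintegral_exponentialPDF_eq_antiDeriv hlam]
  simp

lemma lintegral_expMeasure_Iic (hlam : 0 < lam) {b : ℝ} (hb : 0 ≤ b) {F U : ℝ → ℝ}
    (hF : Continuous F) (hF0 : ∀ s, 0 ≤ s → 0 ≤ F s)
    (hU : ∀ s, HasDerivAt U (lam * (F s - U s)) s) :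
    ∫⁻ t in Set.Iic b, ENNReal.ofReal (F (b - t)) ∂(expMeasure lam) =
      ENNReal.ofReal (U b - Real.exp (-(lam * b)) * U 0) := by
  have := lintegral_expMeasure_Ioc hlam le_rfl hb hF hF0 hU
  simp only [zero_add, mul_zero, neg_zero, Real.exp_zero, one_mul] at this
  rw [← this]
  refine setLIntegral_congr ?_
  rw [← Set.Iic_union_Ioc_eq_Iic hb]
  exact union_ae_eq_right_of_ae_eq_empty (ae_eq_empty.2 (expMeasure_Iic_zero hlam))

/-- The expectation over one step is obtained from a solution of the backward equation. -/
lemma lintegral_killedStep (hlam : 0 < lam) {τ : ℕ → ℝ} (hτ : ∀ b, 0 ≤ τ b) {G : ℕ × ℝ → ℝ}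
    {U : ℕ → ℝ → ℝ} (hG : ∀ q, Continuous fun r => G (q, r))
    (hG0 : ∀ s : ℕ × ℝ, 0 ≤ s.2 → 0 ≤ G s)
    (hU : ∀ q r, HasDerivAt (U q) (lam * (G (q + 1, r) - U q r)) r) {q : ℕ} {r : ℝ} (hr : 0 ≤ r) :
    ∫⁻ t, killedStep τ (fun s => ENNReal.ofReal (G s)) (q, r) t ∂(expMeasure lam) =
      ENNReal.ofReal (U q r - Real.exp (-(lam * r)) * U q 0) + if q = 0 then 0 else
        ENNReal.ofReal (Real.exp (-(lam * r)) *
          (U 0 (τ q) - Real.exp (-(lam * τ q)) * U 0 0)) := by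
  have hsplit : ∀ t, killedStep τ (fun s => ENNReal.ofReal (G s)) (q, r) t =
      (Set.Iic r).indicator (fun t => ENNReal.ofReal (G (q + 1, r - t))) t +
      if q = 0 then 0 else
        (Set.Ioc r (r + τ q)).indicator (fun t => ENNReal.ofReal (G (0 + 1, r + τ q - t))) t := by
    intro t
    simp only [killedStep, step, Set.indicator, Set.mem_Iic, Set.mem_Ioc]
    rcases le_or_gt t r with h1 | h1
    · simp [h1, not_lt.2 h1]
    · by_cases hq : q = 0
      · simp [hq, not_le.2 h1]
      · by_cases h2 : t ≤ r + τ q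
        · simp [hq, h1, not_le.2 h1, h2]
        · simp [hq, not_le.2 h1, h2]
  have hm : ∀ q c, Measurable fun t => ENNReal.ofReal (G (q, c - t)) := fun q c =>
    ((hG q).comp (continuous_const.sub continuous_id)).measurable.ennreal_ofReal
  simp_rw [hsplit]
  rw [lintegral_add_left ((hm _ _).indicator measurableSet_Iic), lintegral_indicator
    measurableSet_Iic, lintegral_expMeasure_Iic hlam hr (hG (q + 1)) (fun s hs => hG0 _ hs) (hU q)]
  congr 1
  split_ifs with hq
  · simp
  · rw [lintegral_indicator measurableSet_Ioc,
      lintegral_expMeasure_Ioc hlam hr (hτ q) (hG (0 + 1)) (fun s hs => hG0 _ hs) (hU 0)]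

end Exponential

/-! ### The drift criterion in differential form. -/

section DriftCriterion

variable {lam : ℝ} {τ : ℕ → ℝ}

lemma killedStep_congr (hτ : ∀ b, 0 ≤ τ b) {F G : ℕ × ℝ → ℝ≥0∞}
    (h : ∀ s : ℕ × ℝ, 0 ≤ s.2 → F s = G s) (s : ℕ × ℝ) (t : ℝ) :
    killedStep τ F s t = killedStep τ G s t := by
  rw [killedStep, killedStep, h _ (step_nonneg hτ s t)]

lemma measurable_of_continuous_snd {f : ℕ × ℝ → ℝ} (hf : ∀ q, Continuous fun r => f (q, r)) :
    Measurable f := measurable_from_prod_countable_right fun q => (hf q).measurable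

/-- A differential form of the drift inequality for Poisson arrivals: the expected total of `p` over
the first cycle, the first job excepted, is at most `V` at the beginning of the cycle plus the
expected total of `m`. -/
lemma tsum_expectAlive_le_of_hasDerivAt (hlam : 0 < lam) (hτ : ∀ b, 0 ≤ τ b) {V p m : ℕ × ℝ → ℝ}
    {κ : ℕ → ℝ} (hVc : ∀ q, Continuous fun r => V (q, r)) (hpc : ∀ q, Continuous fun r => p (q, r))
    (hmc : ∀ q, Continuous fun r => m (q, r)) (hp0 : ∀ s : ℕ × ℝ, 0 ≤ s.2 → 0 ≤ p s)
    (hm0 : ∀ s : ℕ × ℝ, 0 ≤ s.2 → 0 ≤ m s) (hmκ : ∀ q r, m (q + 1, r) = κ q)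
    (hV0 : V (0, 0) = 0) (hVmono : ∀ q r, 0 ≤ r → V (q, 0) ≤ V (q, r))
    (hVq : ∀ q, q ≠ 0 → V (0, τ q) ≤ V (q, 0))
    (hV : ∀ q r, HasDerivAt (fun r => V (q, r))
      (lam * (V (q + 1, r) + p (q + 1, r) - κ q - V (q, r))) r) :
    ∑' n, expectAlive (expMeasure lam) τ (fun s => ENNReal.ofReal (p s)) (n + 1) ≤
      ENNReal.ofReal (V (0, τ 1)) +
        ∑' n, expectAlive (expMeasure lam) τ (fun s => ENNReal.ofReal (m s)) (n + 1) := by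
  have := isProbabilityMeasure_expMeasure hlam
  have hκ : ∀ q, 0 ≤ κ q := fun q => hmκ q 0 ▸ hm0 _ le_rfl
  have hVq0 : ∀ q, 0 ≤ V (q, 0) := fun q => by
    rcases eq_or_ne q 0 with rfl | hq
    · exact hV0.ge
    · exact (hV0.ge.trans (hVmono 0 _ (hτ q))).trans (hVq q hq)
  have hVn : ∀ s : ℕ × ℝ, 0 ≤ s.2 → 0 ≤ V s := fun s hs => (hVq0 s.1).trans (hVmono s.1 s.2 hs)
  refine tsum_expectAlive_le (V := fun s => ENNReal.ofReal (V s)) (expMeasure lam) hτ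
    (measurable_of_continuous_snd hVc).ennreal_ofReal
    (measurable_of_continuous_snd hpc).ennreal_ofReal
    (measurable_of_continuous_snd hmc).ennreal_ofReal ?_
  rintro ⟨q, r⟩ hr
  simp only at hr
  simp_rw [killedStep_congr (G := fun s => ENNReal.ofReal (V s + p s)) hτ fun s hs =>
    (ENNReal.ofReal_add (hVn s hs) (hp0 s hs)).symm]
  -- Both backward equations have explicit solutions: V + κ for the left side and the constant κ for
  -- `m`. The κ terms then cancel, leaving only the comparison of V(0, τ(q)) with V(q, 0).
  rw [lintegral_killedStep hlam hτ (U := fun q r => V (q, r) + κ q)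
      (fun q => (hVc q).add (hpc q)) (fun s hs => add_nonneg (hVn s hs) (hp0 s hs))
      (fun q r => ((hV q r).add_const (κ q)).congr_deriv (by ring)) hr,
    lintegral_killedStep hlam hτ (U := fun q _ => κ q) hmc hm0
      (fun q r => (hasDerivAt_const r (κ q)).congr_deriv (by rw [hmκ]; ring)) hr]
  have he : Real.exp (-(lam * r)) ≤ 1 := Real.exp_le_one_iff.2 (by nlinarith)
  have he0 := Real.exp_pos (-(lam * r))
  have h1 := hVmono q r hr
  have h2 := hVq0 q
  have h3 := hκ q
  have h4 := hVn (q, r) hr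
  have h5 : 0 ≤ κ q - Real.exp (-(lam * r)) * κ q := by nlinarith
  have h6 : 0 ≤ V (q, r) + κ q - Real.exp (-(lam * r)) * (V (q, 0) + κ q) := by nlinarith
  split_ifs with hq
  · simp only [add_zero]
    rw [← ENNReal.ofReal_add h4 h5]
    refine ENNReal.ofReal_le_ofReal ?_
    nlinarith
  · have he' : Real.exp (-(lam * τ q)) ≤ 1 := Real.exp_le_one_iff.2 (by nlinarith [hτ q])
    have h7 : 0 ≤ κ 0 - Real.exp (-(lam * τ q)) * κ 0 := by nlinarith [hκ 0]
    have h8 := hVq q hq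
    have h9 := hVn (0, τ q) (hτ q)
    have h10 : 0 ≤ V (0, τ q) + κ 0 - Real.exp (-(lam * τ q)) * (V (0, 0) + κ 0) := by
      rw [hV0, zero_add]; linarith
    rw [← ENNReal.ofReal_add h6 (mul_nonneg he0.le h10),
      ← ENNReal.ofReal_add h5 (mul_nonneg he0.le h7),
      ← ENNReal.ofReal_add h4 (add_nonneg h5 (mul_nonneg he0.le h7))]
    refine ENNReal.ofReal_le_ofReal ?_
    rw [hV0]
    nlinarith

end DriftCriterion

/-! ### Lyapunov functions for linear processing times. -/

section Linear

variable {lam α τ₀ : ℝ}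

lemma linearTime_nonneg (hα : 0 ≤ α) (hτ₀ : 0 ≤ τ₀) (b : ℕ) : 0 ≤ linearTime α τ₀ b := by
  unfold linearTime; positivity

/-- A linear V with d = 1/(1 - λα) has the right drift except at service completions with fewer than
M jobs collected. The bounded term with factor D repairs these: the new service sees no arrival,
ending the cycle, with probability exp(-λτ(q)), and D is so large that this possibility outweighs
the deficit M - q. -/
lemma tsum_expectAlive_one_ne_top (hlam : 0 < lam) (hα : 0 < α) (hτ₀ : 0 ≤ τ₀)
    (hstable : lam * α < 1) :
    ∑' n, expectAlive (expMeasure lam) (linearTime α τ₀) (fun _ => 1) (n + 1) ≠ ∞ := by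
  obtain ⟨d, hd0, hd⟩ : ∃ d, 0 < d ∧ d * (1 - lam * α) = 1 :=
    ⟨(1 - lam * α)⁻¹, inv_pos.2 (by linarith), inv_mul_cancel₀ (by linarith)⟩
  have hd1 : 1 ≤ d := by nlinarith [mul_pos hlam hα]
  have hτ := linearTime_nonneg hα.le hτ₀
  set M := 2 * d * lam * τ₀ with hM
  have hM0 : 0 ≤ M := by positivity
  set D := M * Real.exp (lam * (α * M + τ₀)) with hD
  have hD0 : 0 ≤ D := by positivity
  have key := tsum_expectAlive_le_of_hasDerivAt hlam hτ (p := fun _ => 1) (m := fun _ => 0)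
    (κ := fun _ => 0) (V := fun s => (2 * d - 1) * s.1 + 2 * d * lam * s.2
      + D * (1 - if s.1 = 0 then Real.exp (-(lam * s.2)) else 0))
    (fun q => by dsimp only; split_ifs <;> fun_prop) (fun q => by fun_prop) (fun q => by fun_prop)
    (fun _ _ => zero_le_one) (fun _ _ => le_rfl) (fun _ _ => rfl) (by simp) ?_ ?_ ?_
  · simp only [ENNReal.ofReal_one, ENNReal.ofReal_zero] at key
    refine ne_top_of_le_ne_top ?_ key
    simp [expectAlive]
  · intro q r hr
    have h1 : 0 ≤ 2 * d * lam * r := by positivity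
    have h2 : Real.exp (-(lam * r)) ≤ 1 := Real.exp_le_one_iff.2 (by nlinarith)
    dsimp only
    split_ifs
    · simp; nlinarith
    · simp; nlinarith
  · intro q hq
    simp only [if_true, if_neg hq, linearTime]
    have h1 : 2 * d * lam * (α * q + τ₀) = (2 * d - 2) * q + M := by
      linear_combination (-2 * q : ℝ) * hd
    have h2 : M - q ≤ D * Real.exp (-(lam * (α * q + τ₀))) := by
      rcases le_or_gt M q with h | h
      · have : 0 ≤ D * Real.exp (-(lam * (α * q + τ₀))) := by positivity
        linarith
      · rw [hD, mul_assoc, ← Real.exp_add]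
        have : 1 ≤ Real.exp (lam * (α * M + τ₀) + -(lam * (α * q + τ₀))) := by
          refine Real.one_le_exp ?_
          have : 0 ≤ lam * α * (M - q) := mul_nonneg (by positivity) (by linarith)
          linarith
        nlinarith [Nat.cast_nonneg (α := ℝ) q]
    push_cast
    linarith
  · intro q r
    dsimp only
    have e0 : HasDerivAt (fun r : ℝ => 2 * d * lam * r) (2 * d * lam) r := by
      simpa using (hasDerivAt_id r).const_mul (2 * d * lam)
    have e1 : HasDerivAt (fun r => Real.exp (-(lam * r))) (Real.exp (-(lam * r)) * (-lam)) r := by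
      have := ((hasDerivAt_id r).const_mul lam).neg.exp
      simpa using this
    by_cases hq : q = 0
    · simp only [hq, if_true]
      refine ((e0.const_add _).add ((e1.const_sub 1).const_mul D)).congr_deriv ?_
      simp
      ring
    · simp only [hq, if_false]
      refine ((e0.const_add _).add_const _).congr_deriv ?_
      simp
      ring

/-- A rate that bounds the mean latency over a cycle, as a function of the state. -/
noncomputable def latencyRate (lam α τ₀ β : ℝ) (s : ℕ × ℝ) : ℝ :=
  τ₀ + β + 2 * (lam / 2 + β * lam ^ 2) * α * τ₀
    + if s.1 ≤ 1 then (lam / 2 + β * lam ^ 2) * τ₀ ^ 2 else 0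

lemma continuous_stateLatency (τ : ℕ → ℝ) (q : ℕ) : Continuous fun r => stateLatency τ (q, r) := by
  unfold stateLatency; fun_prop

lemma stateLatency_linearTime_succ (q : ℕ) (r : ℝ) :
    stateLatency (linearTime α τ₀) (q + 1, r) = r + τ₀ + α * (2 * q + 1) := by
  simp only [stateLatency, linearTime, Nat.add_sub_cancel]
  push_cast
  ring

lemma stateLatency_linearTime_nonneg (hα : 0 ≤ α) (hτ₀ : 0 ≤ τ₀) (s : ℕ × ℝ) (hs : 0 ≤ s.2) :
    0 ≤ stateLatency (linearTime α τ₀) s := by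
  obtain ⟨q, r⟩ := s
  simp only at hs
  cases q with
  | zero => rwa [stateLatency_fresh]
  | succ q => rw [stateLatency_linearTime_succ]; positivity

/-- In the backward equation the coefficient of r gives γ, that of q gives `hβ`, and the constant
term gives κ. For q = 0 no processing time was previously stored in V, whence the extra γτ₀². The
term τ(q)² makes V(0, τ(q)) = V(q, 0) when a batch enters service. -/
lemma tsum_expectAlive_stateLatency_le (hlam : 0 < lam) (hα : 0 ≤ α) (hτ₀ : 0 ≤ τ₀) {β : ℝ}
    (hβ0 : 0 ≤ β) (hβ : β * (1 - lam ^ 2 * α ^ 2) = α + lam * α ^ 2 / 2) :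
    ∑' n, expectAlive (expMeasure lam) (linearTime α τ₀)
        (fun s => ENNReal.ofReal (stateLatency (linearTime α τ₀) s)) (n + 1) ≤
      ENNReal.ofReal ((lam / 2 + β * lam ^ 2) * (α + τ₀) ^ 2) +
        ∑' n, expectAlive (expMeasure lam) (linearTime α τ₀)
          (fun s => ENNReal.ofReal (latencyRate lam α τ₀ β s)) (n + 1) := by
  have hτ := linearTime_nonneg hα hτ₀
  set γ := lam / 2 + β * lam ^ 2 with hγ
  have hγ0 : 0 ≤ γ := by positivity
  have key := tsum_expectAlive_le_of_hasDerivAt hlam hτ (p := stateLatency (linearTime α τ₀))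
    (m := latencyRate lam α τ₀ β)
    (κ := fun q => τ₀ + β + 2 * γ * α * τ₀ + if q = 0 then γ * τ₀ ^ 2 else 0)
    (V := fun s => γ * (s.2 ^ 2 + if s.1 = 0 then 0 else linearTime α τ₀ s.1 ^ 2)
      + 2 * β * lam * s.1 * s.2) (fun q => by dsimp only; split_ifs <;> fun_prop)
    (continuous_stateLatency _)
    (fun q => by unfold latencyRate; dsimp only; split_ifs <;> fun_prop)
    (stateLatency_linearTime_nonneg hα hτ₀) (fun s _ => ?_) (fun q r => ?_) (by simp) ?_ ?_ ?_
  · refine key.trans (le_of_eq ?_)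
    simp [linearTime]
  · rw [latencyRate, ← hγ]
    split_ifs <;> positivity
  · simp [latencyRate, ← hγ]
  · intro q r hr
    have : 0 ≤ 2 * β * lam * q * r := by positivity
    simp only [ne_eq, OfNat.ofNat_ne_zero, not_false_eq_true, zero_pow, zero_add, mul_zero,
      add_zero]
    nlinarith [sq_nonneg r]
  · intro q hq
    simp [hq]
  · intro q r
    dsimp only
    have e0 : HasDerivAt (fun r : ℝ => γ * (r ^ 2 + if q = 0 then 0 else linearTime α τ₀ q ^ 2)
        + 2 * β * lam * q * r) (γ * (2 * r) + 2 * β * lam * q) r := by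
      have h1 := ((hasDerivAt_pow 2 r).add_const
        (if q = 0 then 0 else linearTime α τ₀ q ^ 2)).const_mul γ
      have h2 := (hasDerivAt_id r).const_mul (2 * β * lam * q)
      exact (h1.add h2).congr_deriv (by simp)
    refine e0.congr_deriv ?_
    rw [stateLatency_linearTime_succ, linearTime, linearTime]
    by_cases hq : q = 0
    · simp only [hq, if_true, hγ]
      push_cast
      norm_num
      linear_combination lam * hβ
    · simp only [hq, if_false, Nat.add_eq_zero_iff, false_and, hγ]
      push_cast
      linear_combination (2 * q + 1) * lam * hβ

end Linear

/-! ### Renewal decomposition and passage from cycles to jobs. -/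

section Renewal

variable {τ : ℕ → ℝ}

/-- The index of the first job of the `i`-th cycle. -/
noncomputable def cycleStart (τ x : ℕ → ℝ) (i : ℕ) : ℕ :=
  ∑ j ∈ Finset.range i, cycleLength τ ((nextCycle τ)^[j] x)

lemma cycleStart_succ (τ x : ℕ → ℝ) (i : ℕ) :
    cycleStart τ x (i + 1) = cycleStart τ x i + cycleLength τ ((nextCycle τ)^[i] x) :=
  Finset.sum_range_succ _ _

lemma cycle_spec {x : ℕ → ℝ} (h : ∀ i, Ends τ ((nextCycle τ)^[i] x)) (f : ℕ × ℝ → ℝ) (i : ℕ) :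
    i ≤ cycleStart τ x i ∧ (state τ x (cycleStart τ x i)).1 = 0 ∧
      (nextCycle τ)^[i] x = (fun l => x (cycleStart τ x i + l)) ∧
      ∑ n ∈ Finset.range (cycleStart τ x i), f (state τ x n) =
        ∑ j ∈ Finset.range i, cycleSum τ f ((nextCycle τ)^[j] x) := by
  induction i with
  | zero => simp [cycleStart, state]
  | succ i ih =>
    obtain ⟨h1, h2, h3, h4⟩ := ih
    have hs := (h i).spec
    rw [cycleStart_succ]
    refine ⟨by omega, ?_, ?_, ?_⟩
    · rw [state_add h2, ← h3]
      exact hs.2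
    · rw [Function.iterate_succ_apply']
      funext l
      rw [nextCycle, add_assoc]
      conv_lhs => rw [h3]
      rw [h3]
    · rw [Finset.sum_range_add, h4, Finset.sum_range_succ]
      congr 1
      rw [cycleSum]
      refine Finset.sum_congr rfl fun n _ => ?_
      rw [state_add h2, ← h3]

/-- Long-run averages of nonnegative quantities are determined by their values at the ends of the
cycles. -/
lemma tendsto_div_of_cycles {u : ℕ → ℝ} (hu : Monotone u) {N : ℕ → ℕ} {C : ℕ → ℝ} {e ρ c : ℝ}
    (he : 0 < e) (hN : ∀ i, i ≤ N i) (hNe : Tendsto (fun i : ℕ => (N i : ℝ) / i) atTop (𝓝 e))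
    (hC : Tendsto (fun i : ℕ => C i / i) atTop (𝓝 ρ)) (huN : ∀ i, u (N i + 1) = C i + c) :
    Tendsto (fun n : ℕ => u n / n) atTop (𝓝 (ρ / e)) := by
  have h1 : Tendsto (fun i : ℕ => ((N i + 1 : ℕ) : ℝ) / i) atTop (𝓝 e) := by
    have := hNe.add (tendsto_const_div_atTop_nhds_zero_nat (1 : ℝ))
    rw [add_zero] at this
    refine this.congr fun i => ?_
    push_cast
    ring
  have h2 : Tendsto (fun i : ℕ => u (N i + 1) / i) atTop (𝓝 ρ) := by
    have := hC.add (tendsto_const_div_atTop_nhds_zero_nat c)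
    rw [add_zero] at this
    refine this.congr fun i => ?_
    rw [huN]
    ring
  have h3 : Tendsto (fun i : ℕ => ((N (i + 1) + 1 : ℕ) : ℝ) / i) atTop (𝓝 e) := by
    have h4 := (tendsto_add_atTop_iff_nat 1).2 h1
    have h5 := tendsto_const_nhds (x := (1 : ℝ)).add (tendsto_const_div_atTop_nhds_zero_nat (1 : ℝ))
    have h6 := h4.mul h5
    rw [add_zero, mul_one] at h6
    refine h6.congr' ?_
    filter_upwards [eventually_gt_atTop 0] with i hi
    have : (i : ℝ) ≠ 0 := by positivity
    have : ((i + 1 : ℕ) : ℝ) ≠ 0 := by positivity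
    push_cast at *
    field_simp
  -- The subsequence N i + 1 grows linearly, so its consecutive ratios tend to 1 and monotonicity of
  -- u controls the terms in between.
  refine tendsto_div_of_monotone_of_exists_subseq_tendsto_div u _ hu fun a ha =>
    ⟨fun i => N i + 1, ?_, ?_, ?_⟩
  · have h4 : Tendsto (fun i : ℕ => a * (((N i + 1 : ℕ) : ℝ) / i) - ((N (i + 1) + 1 : ℕ) : ℝ) / i)
        atTop (𝓝 (a * e - e)) := (h1.const_mul a).sub h3
    filter_upwards [h4.eventually (lt_mem_nhds (show 0 < a * e - e by nlinarith)),
      eventually_gt_atTop 0] with i hi hi0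
    have hi0' : (0 : ℝ) < i := by exact_mod_cast hi0
    rw [← mul_div_assoc, ← sub_div] at hi
    have := (div_pos_iff_of_pos_right hi0').1 hi
    linarith
  · exact tendsto_atTop_mono (fun i => (hN i).trans (Nat.le_succ _)) tendsto_id
  · refine (h2.div h1 he.ne').congr' ?_
    filter_upwards [eventually_gt_atTop 0] with i hi
    have : (i : ℝ) ≠ 0 := by positivity
    simp only [Pi.div_apply]
    field_simp

end Renewal

/-! ### Mean and positivity of the interarrival times. -/

section Law

variable {lam : ℝ}

lemma lintegral_ofReal_expMeasure (hlam : 0 < lam) :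
    ∫⁻ t, ENNReal.ofReal t ∂(expMeasure lam) = ENNReal.ofReal (1 / lam) := by
  have h1 : expMeasure lam = volume.withDensity (exponentialPDF lam) := rfl
  have hpdf : Measurable (exponentialPDF lam) := (measurable_exponentialPDFReal lam).ennreal_ofReal
  have hi := Real.integral_rpow_mul_exp_neg_mul_Ioi (a := 2) two_pos hlam
  norm_num at hi
  rw [h1, lintegral_withDensity_eq_lintegral_mul _ hpdf ENNReal.measurable_ofReal]
  have h2 : ∀ t : ℝ, (exponentialPDF lam * ENNReal.ofReal) t =
      (Set.Ioi 0).indicator (fun t => ENNReal.ofReal (lam * (t * Real.exp (-(lam * t))))) t := by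
    intro t
    simp only [Pi.mul_apply, Set.indicator, Set.mem_Ioi]
    split_ifs with ht
    · rw [exponentialPDF_of_nonneg ht.le, ← ENNReal.ofReal_mul (by positivity)]
      ring_nf
    · rw [ENNReal.ofReal_of_nonpos (not_lt.1 ht), mul_zero]
  simp_rw [h2]
  rw [lintegral_indicator measurableSet_Ioi, ← ofReal_integral_eq_lintegral_ofReal]
  · rw [integral_const_mul, hi]
    congr 1
    field_simp
  · refine Integrable.const_mul ?_ _
    by_contra h
    rw [integral_undef h] at hi
    have : (lam ^ 2)⁻¹ ≠ 0 := by positivity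
    exact this hi.symm
  · refine (ae_restrict_iff' measurableSet_Ioi).2 (Eventually.of_forall fun t ht => ?_)
    have : 0 < t := ht
    positivity

lemma ae_pos_expMeasure (hlam : 0 < lam) : ∀ᵐ t ∂(expMeasure lam), 0 < t := by
  rw [ae_iff]
  simp only [not_lt]
  exact expMeasure_Iic_zero hlam

lemma integrable_of_lintegral_ofReal {Ω : Type*} [MeasurableSpace Ω] {μ : Measure Ω} {f : Ω → ℝ}
    (hf : Measurable f) (hf0 : 0 ≤ᵐ[μ] f) (h : ∫⁻ x, ENNReal.ofReal (f x) ∂μ ≠ ∞) :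
    Integrable f μ :=
  ⟨hf.aestronglyMeasurable, (hasFiniteIntegral_iff_ofReal hf0).2 h.lt_top⟩

lemma tendsto_sum_iidLaw (hlam : 0 < lam) :
    ∀ᵐ x : ℕ → ℝ ∂(iidLaw (expMeasure lam)),
      Tendsto (fun n : ℕ => (∑ i ∈ Finset.range n, x i) / (n : ℝ)) atTop (𝓝 (1 / lam)) := by
  have := isProbabilityMeasure_expMeasure hlam
  have hmap := map_eval_iidLaw (expMeasure lam)
  have hid : ∀ᵐ t ∂(expMeasure lam), 0 ≤ t := (ae_pos_expMeasure hlam).mono fun t ht => ht.le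
  have hint : Integrable (fun t : ℝ => t) (expMeasure lam) :=
    integrable_of_lintegral_ofReal measurable_id hid
      (by rw [lintegral_ofReal_expMeasure hlam]; exact ENNReal.ofReal_ne_top)
  have hmean : ∫ t, t ∂(expMeasure lam) = 1 / lam := by
    rw [integral_eq_lintegral_of_nonneg_ae hid measurable_id.aestronglyMeasurable,
      lintegral_ofReal_expMeasure hlam, ENNReal.toReal_ofReal (by positivity)]
  have h := strong_law_ae_real (fun (i : ℕ) (x : ℕ → ℝ) => x i) (μ := iidLaw (expMeasure lam)) ?_
    (fun i j hij => (iIndepFun_iidLaw (expMeasure lam)).indepFun hij)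
    (fun i => ⟨(measurable_pi_apply i).aemeasurable, (measurable_pi_apply 0).aemeasurable,
      (hmap i).trans (hmap 0).symm⟩)
  · have h0 : ∫ x : ℕ → ℝ, x 0 ∂(iidLaw (expMeasure lam)) = 1 / lam := by
      rw [← hmean]
      conv_rhs => rw [← hmap 0]
      exact (integral_map (φ := fun x : ℕ → ℝ => x 0) (measurable_pi_apply 0).aemeasurable
        measurable_id.aestronglyMeasurable).symm
    rwa [h0] at h
  · have : Integrable (fun t : ℝ => t) ((iidLaw (expMeasure lam)).map fun x => x 0) := by
      rwa [hmap 0]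
    exact this.comp_measurable (measurable_pi_apply 0)

lemma ae_pos_iidLaw (hlam : 0 < lam) : ∀ᵐ x ∂(iidLaw (expMeasure lam)), ∀ i, 0 < x i := by
  have := isProbabilityMeasure_expMeasure hlam
  rw [ae_all_iff]
  intro i
  have h := ae_pos_expMeasure hlam
  rw [← map_eval_iidLaw (expMeasure lam) i] at h
  exact ae_of_ae_map (measurable_pi_apply i).aemeasurable h

end Law

/-! ### Cycle expectations, the two bounds and almost sure convergence. -/

section MeanLatency

variable {lam α τ₀ : ℝ}

lemma cycleSum_nonneg {τ : ℕ → ℝ} (hτ : ∀ b, 0 ≤ τ b) {f : ℕ × ℝ → ℝ}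
    (hf0 : ∀ s : ℕ × ℝ, 0 ≤ s.2 → 0 ≤ f s) (x : ℕ → ℝ) : 0 ≤ cycleSum τ f x :=
  Finset.sum_nonneg fun i _ => hf0 _ (state_nonneg hτ x i)

lemma cycleSum_one (τ x : ℕ → ℝ) : cycleSum τ (fun _ => 1) x = cycleLength τ x := by
  simp [cycleSum]

lemma ae_iterate_ends {τ : ℕ → ℝ} {η : Measure ℝ} [IsProbabilityMeasure η]
    (hE : ∀ᵐ x ∂(iidLaw η), Ends τ x) :
    ∀ᵐ x ∂(iidLaw η), ∀ i, Ends τ ((nextCycle τ)^[i] x) := by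
  rw [ae_all_iff]
  exact fun i => ((measurePreserving_nextCycle hE).iterate i).quasiMeasurePreserving.ae hE

lemma continuous_stateWork (α τ₀ : ℝ) (q : ℕ) : Continuous fun r => stateWork α τ₀ (q, r) := by
  unfold stateWork; exact continuous_of_const fun _ _ => rfl

lemma stateWork_nonneg (hα : 0 ≤ α) (hτ₀ : 0 ≤ τ₀) (s : ℕ × ℝ) : 0 ≤ stateWork α τ₀ s := by
  unfold stateWork; split_ifs <;> positivity

lemma stateWork_le (hτ₀ : 0 ≤ τ₀) (s : ℕ × ℝ) : stateWork α τ₀ s ≤ α + τ₀ := by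
  unfold stateWork; split_ifs <;> linarith

lemma latencyRate_eq (lam α τ₀ β : ℝ) (s : ℕ × ℝ) : latencyRate lam α τ₀ β s =
    (τ₀ + β + (lam / 2 + β * lam ^ 2) * α * τ₀) * 1
      + (lam / 2 + β * lam ^ 2) * τ₀ * stateWork α τ₀ s := by
  unfold latencyRate stateWork
  split_ifs <;> ring

lemma cycleSum_latencyRate (τ : ℕ → ℝ) (lam α τ₀ β : ℝ) (x : ℕ → ℝ) :
    cycleSum τ (latencyRate lam α τ₀ β) x =
      (τ₀ + β + (lam / 2 + β * lam ^ 2) * α * τ₀) * cycleSum τ (fun _ => 1) x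
        + (lam / 2 + β * lam ^ 2) * τ₀ * cycleSum τ (stateWork α τ₀) x := by
  simp only [cycleSum, latencyRate_eq, Finset.sum_add_distrib, Finset.mul_sum]

lemma integrable_cycleSum_one (hlam : 0 < lam) (hα : 0 < α) (hτ₀ : 0 ≤ τ₀)
    (hstable : lam * α < 1)
    (hE : ∀ᵐ x ∂(iidLaw (expMeasure lam)), Ends (linearTime α τ₀) x) :
    Integrable (cycleSum (linearTime α τ₀) (fun _ => 1)) (iidLaw (expMeasure lam)) := by
  have := isProbabilityMeasure_expMeasure hlam
  have hτ := linearTime_nonneg hα.le hτ₀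
  refine integrable_of_lintegral_ofReal (measurable_cycleSum measurable_const)
    (Eventually.of_forall (cycleSum_nonneg hτ fun _ _ => zero_le_one)) ?_
  rw [lintegral_cycleSum hE hτ measurable_const fun _ _ => zero_le_one]
  simp only [ENNReal.ofReal_one]
  exact ENNReal.add_ne_top.2 ⟨ENNReal.one_ne_top,
    tsum_expectAlive_one_ne_top hlam hα hτ₀ hstable⟩

/-- The estimate behind φ₀: each job adds at most α + τ₀ of work. -/
lemma integrable_cycleSum_stateWork (hα : 0 ≤ α) (hτ₀ : 0 ≤ τ₀) {τ : ℕ → ℝ}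
    {μ : Measure (ℕ → ℝ)} (h : Integrable (cycleSum τ (fun _ => 1)) μ) :
    Integrable (cycleSum τ (stateWork α τ₀)) μ ∧
      ∫ x, cycleSum τ (stateWork α τ₀) x ∂μ ≤ (α + τ₀) * ∫ x, cycleSum τ (fun _ => 1) x ∂μ := by
  have hle : ∀ x, cycleSum τ (stateWork α τ₀) x ≤ (α + τ₀) * cycleSum τ (fun _ => 1) x :=
    fun x => by
      rw [cycleSum, cycleSum, Finset.mul_sum]
      exact Finset.sum_le_sum fun i _ => by rw [mul_one]; exact stateWork_le hτ₀ _
  have hint : Integrable (cycleSum τ (stateWork α τ₀)) μ := by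
    refine (h.const_mul (α + τ₀)).mono' (measurable_cycleSum
      (measurable_of_continuous_snd (continuous_stateWork α τ₀))).aestronglyMeasurable
      (Eventually.of_forall fun x => ?_)
    refine (Real.norm_of_nonneg ?_).trans_le (hle x)
    exact Finset.sum_nonneg fun i _ => stateWork_nonneg hα hτ₀ _
  refine ⟨hint, ?_⟩
  rw [← integral_const_mul]
  exact integral_mono hint (h.const_mul _) hle

lemma integral_cycleSum_stateLatency_le (hlam : 0 < lam) (hα : 0 < α) (hτ₀ : 0 ≤ τ₀)
    (hE : ∀ᵐ x ∂(iidLaw (expMeasure lam)), Ends (linearTime α τ₀) x) {β : ℝ}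
    (hβ0 : 0 ≤ β) (hβ : β * (1 - lam ^ 2 * α ^ 2) = α + lam * α ^ 2 / 2)
    (h : Integrable (cycleSum (linearTime α τ₀) (latencyRate lam α τ₀ β))
      (iidLaw (expMeasure lam))) :
    Integrable (cycleSum (linearTime α τ₀) (stateLatency (linearTime α τ₀)))
        (iidLaw (expMeasure lam)) ∧
      ∫ x, cycleSum (linearTime α τ₀) (stateLatency (linearTime α τ₀)) x
          ∂(iidLaw (expMeasure lam)) ≤
        ∫ x, cycleSum (linearTime α τ₀) (latencyRate lam α τ₀ β) x
          ∂(iidLaw (expMeasure lam)) := by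
  have := isProbabilityMeasure_expMeasure hlam
  have hτ := linearTime_nonneg hα.le hτ₀
  have hR0 : ∀ s : ℕ × ℝ, 0 ≤ s.2 → 0 ≤ latencyRate lam α τ₀ β s := fun s _ => by
    rw [latencyRate_eq]
    have := stateWork_nonneg hα.le hτ₀ s
    positivity
  have hL0 := stateLatency_linearTime_nonneg hα.le hτ₀
  have hRm : Measurable (latencyRate lam α τ₀ β) :=
    measurable_of_continuous_snd fun q => by unfold latencyRate; exact continuous_of_const fun _ _ => rfl
  have hLm : Measurable (stateLatency (linearTime α τ₀)) :=
    measurable_of_continuous_snd (continuous_stateLatency _)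
  have hle : ∫⁻ x, ENNReal.ofReal (cycleSum (linearTime α τ₀) (stateLatency (linearTime α τ₀)) x)
        ∂(iidLaw (expMeasure lam)) ≤
      ∫⁻ x, ENNReal.ofReal (cycleSum (linearTime α τ₀) (latencyRate lam α τ₀ β) x)
        ∂(iidLaw (expMeasure lam)) := by
    rw [lintegral_cycleSum hE hτ hLm hL0, lintegral_cycleSum hE hτ hRm hR0]
    refine (add_le_add_right (tsum_expectAlive_stateLatency_le hlam hα.le hτ₀ hβ0 hβ) _).trans ?_
    rw [← add_assoc, ← ENNReal.ofReal_add (hL0 _ (hτ 1)) (by positivity)]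
    refine le_of_eq ?_
    congr 2
    simp only [stateLatency_fresh, linearTime, latencyRate, Nat.cast_one, mul_one, zero_le,
      if_true]
    -- The first job's latency plus the initial V, (α + τ₀) + γ(α + τ₀)², equals the rate at the
    -- initial state, so no boundary term survives.
    linear_combination (-1 : ℝ) * hβ
  have hint := integrable_of_lintegral_ofReal (measurable_cycleSum (τ := linearTime α τ₀) hLm)
    (Eventually.of_forall (cycleSum_nonneg hτ hL0))
    (ne_top_of_le_ne_top (by
      rw [← ofReal_integral_eq_lintegral_ofReal h
        (Eventually.of_forall (cycleSum_nonneg hτ hR0))]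
      exact ENNReal.ofReal_ne_top) hle)
  refine ⟨hint, ?_⟩
  rw [← ofReal_integral_eq_lintegral_ofReal h (Eventually.of_forall (cycleSum_nonneg hτ hR0)),
    ← ofReal_integral_eq_lintegral_ofReal hint (Eventually.of_forall (cycleSum_nonneg hτ hL0)),
    ENNReal.ofReal_le_ofReal_iff (integral_nonneg (cycleSum_nonneg hτ hR0))] at hle
  exact hle

/-- φ₀ is the bound A + γτ₀·w/e with w/e replaced by α + τ₀. -/
lemma phi0_eq (hlam : 0 < lam) (hα : 0 < α) (hstable : lam * α < 1) {β : ℝ}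
    (hβ : β * (1 - lam ^ 2 * α ^ 2) = α + lam * α ^ 2 / 2) :
    phi0 lam α τ₀ = τ₀ + β + (lam / 2 + β * lam ^ 2) * α * τ₀
      + (lam / 2 + β * lam ^ 2) * τ₀ * (α + τ₀) := by
  have h1 : 1 - lam * α ≠ 0 := by linarith
  have h1' : 1 - α * lam ≠ 0 := by linarith
  have h2 : 1 + lam * α ≠ 0 := by positivity
  have h3 : 1 - lam ^ 2 * α ^ 2 ≠ 0 := by
    rw [show 1 - lam ^ 2 * α ^ 2 = (1 - lam * α) * (1 + lam * α) by ring]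
    exact mul_ne_zero h1 h2
  rw [eq_div_of_mul_eq h3 hβ, phi0,
    show 1 - lam ^ 2 * α ^ 2 = (1 - lam * α) * (1 + lam * α) by ring]
  field_simp
  ring

/-- φ₁ is the same expression with w/e replaced by 1/λ. -/
lemma phi1_eq (hlam : 0 < lam) (hα : 0 < α) (hstable : lam * α < 1) {β : ℝ}
    (hβ : β * (1 - lam ^ 2 * α ^ 2) = α + lam * α ^ 2 / 2) :
    phi1 lam α τ₀ = τ₀ + β + (lam / 2 + β * lam ^ 2) * α * τ₀
      + (lam / 2 + β * lam ^ 2) * τ₀ * (1 / lam) := by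
  have h1 : 1 - lam * α ≠ 0 := by linarith
  have h2 : 1 + lam * α ≠ 0 := by positivity
  have h3 : 1 - lam ^ 2 * α ^ 2 ≠ 0 := by
    rw [show 1 - lam ^ 2 * α ^ 2 = (1 - lam * α) * (1 + lam * α) by ring]
    exact mul_ne_zero h1 h2
  rw [eq_div_of_mul_eq h3 hβ, phi1,
    show 1 - lam ^ 2 * α ^ 2 = (1 - lam * α) * (1 + lam * α) by ring]
  field_simp
  ring

lemma phi0_le_phi1_iff (hlam : 0 < lam) (hα : 0 < α) (hτ₀ : 0 ≤ τ₀) (hstable : lam * α < 1) :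
    phi0 lam α τ₀ ≤ phi1 lam α τ₀ ↔ lam ≤ 1 / (α + τ₀) := by
  have h1 : 1 - lam ^ 2 * α ^ 2 ≠ 0 := by
    rw [show 1 - lam ^ 2 * α ^ 2 = (1 - lam * α) * (1 + lam * α) by ring]
    have : 0 < 1 - lam * α := by linarith
    positivity
  have hβ := div_mul_cancel₀ (α + lam * α ^ 2 / 2) h1
  have hβ0 : 0 ≤ (α + lam * α ^ 2 / 2) / (1 - lam ^ 2 * α ^ 2) := by
    refine div_nonneg (by positivity) ?_
    nlinarith [mul_pos hlam hα]
  rw [phi0_eq hlam hα hstable hβ, phi1_eq hlam hα hstable hβ, add_le_add_iff_left]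
  set γ := lam / 2 + (α + lam * α ^ 2 / 2) / (1 - lam ^ 2 * α ^ 2) * lam ^ 2
  have hγ : 0 < γ := by positivity
  rw [le_div_iff₀ (by positivity)]
  -- If τ₀ = 0 the two bounds coincide and the condition on λ is the stability condition; otherwise
  -- γτ₀ > 0 cancels.
  rcases hτ₀.eq_or_lt with rfl | hτ₀
  · simp [hstable.le]
  · rw [mul_le_mul_iff_right₀ (by positivity), le_div_iff₀ hlam, mul_comm]

/-- The average of the latencies converges along almost every sequence of interarrival times. -/
lemma exists_meanLatency_iidLaw (hlam : 0 < lam) (hα : 0 < α) (hτ₀ : 0 ≤ τ₀)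
    (hstable : lam * α < 1) :
    ∃ EW, EW ≤ phi0 lam α τ₀ ∧ EW ≤ phi1 lam α τ₀ ∧
      ∀ᵐ x ∂(iidLaw (expMeasure lam)), ∀ T : ℕ → ℝ, (∀ i, 0 < T i) → (fun i => T (i + 1)) = x →
        Tendsto (fun N : ℕ => (∑ n ∈ Finset.range N, latency (linearTime α τ₀) T n) / (N : ℝ))
          atTop (𝓝 EW) := by
  have := isProbabilityMeasure_expMeasure hlam
  have hτ := linearTime_nonneg hα.le hτ₀
  set τ := linearTime α τ₀ with hτdef
  set μ := iidLaw (expMeasure lam)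
  have hE : ∀ᵐ x ∂μ, Ends τ x :=
    ae_ends_of_tsum_ne_top _ (tsum_expectAlive_one_ne_top hlam hα hτ₀ hstable)
  have hEi := ae_iterate_ends hE
  obtain ⟨β, hβ0, hβ⟩ : ∃ β, 0 ≤ β ∧ β * (1 - lam ^ 2 * α ^ 2) = α + lam * α ^ 2 / 2 := by
    have h1 : 0 < 1 - lam ^ 2 * α ^ 2 := by nlinarith [mul_pos hlam hα]
    exact ⟨_, div_nonneg (by positivity) h1.le, div_mul_cancel₀ _ h1.ne'⟩
  have hint1 := integrable_cycleSum_one hlam hα hτ₀ hstable hE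
  obtain ⟨hintW, hW⟩ := integrable_cycleSum_stateWork hα.le hτ₀ hint1
  have hintR : Integrable (cycleSum τ (latencyRate lam α τ₀ β)) μ := by
    simp_rw [funext (cycleSum_latencyRate τ lam α τ₀ β)]
    exact (hint1.const_mul _).add (hintW.const_mul _)
  obtain ⟨hintL, hL⟩ := integral_cycleSum_stateLatency_le hlam hα hτ₀ hE hβ0 hβ hintR
  simp_rw [cycleSum_latencyRate] at hL
  rw [integral_add (hint1.const_mul _) (hintW.const_mul _), integral_const_mul,
    integral_const_mul] at hL
  have lim1 := tendsto_cycleSum hE measurable_const hint1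
  have limW := tendsto_cycleSum hE
    (measurable_of_continuous_snd (continuous_stateWork α τ₀)) hintW
  have limL := tendsto_cycleSum hE (measurable_of_continuous_snd (continuous_stateLatency τ)) hintL
  set e := ∫ x, cycleSum τ (fun _ => 1) x ∂μ with he
  set w := ∫ x, cycleSum τ (stateWork α τ₀) x ∂μ
  set ρ := ∫ x, cycleSum τ (stateLatency τ) x ∂μ
  have he1 : 1 ≤ e := by
    have : ∫ _, (1 : ℝ) ∂μ ≤ e := integral_mono_ae (integrable_const 1) hint1 <| by
      filter_upwards [hE] with x hx
      rw [cycleSum_one]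
      exact_mod_cast hx.spec.1
    simpa using this
  have he0 : 0 < e := by linarith
  have hN : ∀ x : ℕ → ℝ, ∀ i, ∑ j ∈ Finset.range i, cycleSum τ (fun _ => 1) ((nextCycle τ)^[j] x)
      = cycleStart τ x i := fun x i => by simp [cycleSum_one, cycleStart]
  simp_rw [hN] at lim1
  -- The estimate behind φ₁, read off one typical path: at cycle starts, work done so far is at most
  -- elapsed time plus τ(1). Dividing by the number of cycles gives w on the left and (1/λ)·e on the
  -- right.
  have hwe : w ≤ 1 / lam * e := by
    obtain ⟨x, h1, h2, h3, h4, h5⟩ := (hEi.and (lim1.and (limW.and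
      ((tendsto_sum_iidLaw hlam).and (ae_pos_iidLaw hlam))))).exists
    have hst : Tendsto (cycleStart τ x) atTop atTop :=
      tendsto_atTop_mono (fun i => (cycle_spec h1 0 i).1) tendsto_id
    have hlim := ((h4.comp hst).mul h2).add (tendsto_const_div_atTop_nhds_zero_nat (τ 1))
    rw [add_zero] at hlim
    refine le_of_tendsto_of_tendsto h3 hlim ?_
    filter_upwards [eventually_gt_atTop 0] with i hi
    obtain ⟨c1, c2, -, c4⟩ := cycle_spec h1 (stateWork α τ₀) i
    have hi' : (0 : ℝ) < i := by exact_mod_cast hi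
    have hc : (0 : ℝ) < cycleStart τ x i := by exact_mod_cast hi.trans_le c1
    have hwork := sum_stateWork_le hα.le hτ₀ (fun i => (h5 i).le) (cycleStart τ x i)
    rw [Finset.sum_range_succ, ← hτdef, c4, c2, if_pos rfl, state_of_fst_eq_zero c2] at hwork
    have := stateWork_nonneg hα.le hτ₀ (0, τ 1)
    simp only [Function.comp_apply]
    rw [div_mul_div_cancel₀ hc.ne', ← add_div]
    exact div_le_div_of_nonneg_right (by linarith) hi'.le
  have hγ : 0 ≤ (lam / 2 + β * lam ^ 2) * τ₀ := by positivity
  refine ⟨ρ / e, ?_, ?_, ?_⟩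
  · rw [div_le_iff₀ he0, phi0_eq hlam hα hstable hβ]
    have := mul_le_mul_of_nonneg_left hW hγ
    linarith
  · rw [div_le_iff₀ he0, phi1_eq hlam hα hstable hβ]
    have := mul_le_mul_of_nonneg_left hwe hγ
    linarith
  · filter_upwards [hEi, lim1, limL] with x h1 h2 h3
    rintro T hT rfl
    -- Job n precedes or is the start of cycle n, where its latency is settled and known to be
    -- nonnegative.
    have hmono : Monotone fun N => ∑ n ∈ Finset.range N, latency τ T n := by
      refine monotone_nat_of_le_succ fun n => ?_
      rw [Finset.sum_range_succ]
      obtain ⟨c1, c2, -⟩ := cycle_spec h1 0 n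
      linarith [latency_nonneg_of_fresh hτ hT c2 c1]
    -- The sum up to and including the first job of cycle i exceeds the completed cycles by that
    -- job's charge τ(1).
    refine tendsto_div_of_cycles (c := τ 1) hmono he0 (fun i => (cycle_spec h1 0 i).1) h2 h3 ?_
    intro i
    obtain ⟨-, c2, -, c4⟩ := cycle_spec h1 (stateLatency τ) i
    rw [sum_latency_of_fresh hτ hT c2, Finset.sum_range_succ, c4, state_of_fst_eq_zero c2,
      stateLatency_fresh]

end MeanLatency

/-! ### Transfer to an arbitrary Poisson input. -/

lemma IsPoissonInput.ae_pos {Ω : Type*} [MeasurableSpace Ω] {P : Measure Ω} {lam : ℝ}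
    {T : ℕ → Ω → ℝ} (hT : IsPoissonInput P lam T) (hlam : 0 < lam) :
    ∀ᵐ ω ∂P, ∀ i, 0 < T i ω := by
  rw [ae_all_iff]
  intro i
  have h := ae_pos_expMeasure hlam
  rw [← (hT.hasLaw i).map_eq] at h
  exact ae_of_ae_map (hT.hasLaw i).aemeasurable h

/-- The chain starts at the arrival of job 0, so only the interarrival times from index 1 on drive
it. -/
lemma IsPoissonInput.hasLaw_shift {Ω : Type*} [MeasurableSpace Ω] {P : Measure Ω} {lam : ℝ}
    {T : ℕ → Ω → ℝ} (hT : IsPoissonInput P lam T) :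
    HasLaw (fun ω i => T (i + 1) ω) (iidLaw (expMeasure lam)) P :=
  iIndepFun.hasLaw_infinitePi (fun i => hT.hasLaw (i + 1))
    (hT.indep.precomp (add_left_injective 1))
    (aemeasurable_pi_lambda _ fun i => (hT.hasLaw (i + 1)).aemeasurable)

end BatchQueue

theorem theorem2 {Ω : Type*} [MeasurableSpace Ω] (P : Measure Ω) [IsProbabilityMeasure P]
    (lam α τ₀ : ℝ) (hlam : 0 < lam) (hα : 0 < α) (hτ₀ : 0 ≤ τ₀) (hstable : lam * α < 1)
    (T : ℕ → Ω → ℝ) (hT : BatchQueue.IsPoissonInput P lam T) :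
    (∃ EW : ℝ, BatchQueue.IsMeanLatency P (BatchQueue.linearTime α τ₀) T EW ∧
      EW ≤ BatchQueue.phi0 lam α τ₀ ∧ EW ≤ BatchQueue.phi1 lam α τ₀) ∧
    (BatchQueue.phi0 lam α τ₀ ≤ BatchQueue.phi1 lam α τ₀ ↔ lam ≤ 1 / (α + τ₀)) := by
  refine ⟨?_, BatchQueue.phi0_le_phi1_iff hlam hα hτ₀ hstable⟩
  obtain ⟨EW, h0, h1, h⟩ := BatchQueue.exists_meanLatency_iidLaw hlam hα hτ₀ hstable
  refine ⟨EW, ?_, h0, h1⟩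
  rw [← hT.hasLaw_shift.map_eq] at h
  filter_upwards [ae_of_ae_map hT.hasLaw_shift.aemeasurable h, hT.ae_pos hlam] with ω hω hpos
  exact hω (fun i => T i ω) hpos rfl
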